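/- Let $\mathbb{C}P^n$ carry the Fubini–Study metric with fundamental form $\omega_{FS}=\frac{\sqrt{-1}}{2\pi}\,\partial\bar\partial\log\bigl(1+\sum_{i=1}^n|z_i|^2\bigr)$ in affine coordinates. For a complex manifold $X$ with a Hermitian metric $g$ and fundamental form $\omega(u,v)=g(Ju,v)$, and a holomorphic curve $f:\mathbb{C}\to X$, let $|df|(z)\ge 0$ be defined by $f^*\omega=|df|^2\,dx\wedge dy$ $(z=x+\sqrt{-1}\,y)$, i.e. $|df|(z)$ is the length of $df(\partial/\partial x)$. The packing density of $f$ is $$\rho(f):=\limsup_{R\to\infty}\frac{1}{\pi R^2}\int_{|z|\le R}|df|^2\,dx\,dy ,$$ and the holomorphic capacity $\rho(X,\omega)$ is the supremum of $\rho(f)$ over all holomorphic $f:\mathbb{C}\to X$ with $|df|(z)\le 1$ for all $z\in\mathbb{C}$. **Theorem.** Let $A=(a_{ij})_{0\le i,j\le n}$ be an invertible complex matrix and let $H_i=\{[z_0:\cdots:z_n] : \sum_{j=0}^n a_{ij}z_j=0\}$, $0\le i\le n$, so that $H_0,\dots,H_n$ are $n+1$ linearly independent hyperplanes in $\mathbb{C}P^n$.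 Then $$\rho\bigl(\mathbb{C}P^n\setminus(H_0\cup\cdots\cup H_n),\,\omega_{FS}\bigr)=0,$$ where the complement carries the restricted Fubini–Study metric. Moreover, every holomorphic curve $f:\mathbb{C}\to\mathbb{C}P^n\setminus(H_0\cup\cdots\cup H_n)$ with $\sup_{z\in\mathbb{C}}|df|(z)<\infty$ has packing density $\rho(f)=0$. -/

import Mathlib

open scoped Manifold ContDiff ENNReal InnerProductSpace
open MeasureTheory Filter

noncomputable section

/-! ## Hermitian metrics, packing density and holomorphic capacity

A complex manifold of dimension `n` is a space charted on `ℂⁿ` with analytic transition maps. Its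
tangent space at a point (over the field `ℂ`) is the real tangent space together with the complex
structure `J`, which is multiplication by `Complex.I`. -/

/-- A Hermitian metric on a complex manifold `X`: a (smooth) Riemannian metric `g` which is compatible
with the complex structure, `g (J u) (J v) = g u v`. -/
structure HermitianMetric (n : ℕ) (X : Type*) [TopologicalSpace X]
    [ChartedSpace (EuclideanSpace ℂ (Fin n)) X]
    [IsManifold 𝓘(ℂ, EuclideanSpace ℂ (Fin n)) ω X] where
  /-- the real inner product on the tangent space at `p` -/
  inner (p : X) (u v : TangentSpace 𝓘(ℂ, EuclideanSpace ℂ (Fin n)) p) : ℝ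
  add_left : ∀ p u u' v, inner p (u + u') v = inner p u v + inner p u' v
  smul_left : ∀ p (r : ℝ) u v, inner p ((r : ℂ) • u) v = r * inner p u v
  symm : ∀ p u v, inner p u v = inner p v u
  pos : ∀ p u, u ≠ 0 → 0 < inner p u u
  compat : ∀ p u v, inner p (Complex.I • u) (Complex.I • v) = inner p u v
  /-- the coefficients of the metric in every chart are smooth functions of the coordinates -/
  smooth : ∀ e ∈ atlas (EuclideanSpace ℂ (Fin n)) X, ∀ u v : EuclideanSpace ℂ (Fin n),
    ContDiffOn ℝ ∞ (fun x => inner (e.symm x)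
      (mfderiv 𝓘(ℂ, EuclideanSpace ℂ (Fin n)) 𝓘(ℂ, EuclideanSpace ℂ (Fin n)) e.symm x u)
      (mfderiv 𝓘(ℂ, EuclideanSpace ℂ (Fin n)) 𝓘(ℂ, EuclideanSpace ℂ (Fin n)) e.symm x v)) e.target

section capacity

variable {n : ℕ} {X : Type*} [TopologicalSpace X] [ChartedSpace (EuclideanSpace ℂ (Fin n)) X]

/-- A holomorphic curve `f : ℂ → X`. -/
def IsHolomorphicCurve (n : ℕ) {X : Type*} [TopologicalSpace X]
    [ChartedSpace (EuclideanSpace ℂ (Fin n)) X] (f : ℂ → X) : Prop :=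
  MDifferentiable 𝓘(ℂ, ℂ) 𝓘(ℂ, EuclideanSpace ℂ (Fin n)) f

variable [IsManifold 𝓘(ℂ, EuclideanSpace ℂ (Fin n)) ω X]

/-- The norm `|df|(z)` of the differential of a holomorphic curve: the length of the tangent vector
`df(∂/∂x)`. As `df(∂/∂y) = J df(∂/∂x)` has the same length and is orthogonal to it, this is
`√2 |df(∂/∂z)|` for the Hermitian extension of the metric to the complexified tangent space, and
`f^*ω = |df|² dx ∧ dy` for the fundamental form `ω(u, v) = g(J u, v)`. -/
def HermitianMetric.normDeriv (g : HermitianMetric n X) (f : ℂ → X) (z : ℂ) : ℝ :=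
  √(g.inner (f z) (mfderiv 𝓘(ℂ, ℂ) 𝓘(ℂ, EuclideanSpace ℂ (Fin n)) f z (1 : ℂ))
    (mfderiv 𝓘(ℂ, ℂ) 𝓘(ℂ, EuclideanSpace ℂ (Fin n)) f z (1 : ℂ)))

/-- The space `𝓜(X, ω)` of holomorphic curves with `|df| ≤ 1`. -/
def HermitianMetric.moduli (g : HermitianMetric n X) : Set (ℂ → X) :=
  {f | IsHolomorphicCurve n f ∧ ∀ z, g.normDeriv f z ≤ 1}

/-- The packing density `ρ(f) = limsup_{R → ∞} (1 / (π R²)) ∫_{|z| ≤ R} |df|² dx dy`, as an extended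
nonnegative real number. -/
def HermitianMetric.packingDensity (g : HermitianMetric n X) (f : ℂ → X) : ℝ≥0∞ :=
  limsup (fun R : ℝ => (∫⁻ z in Metric.closedBall (0 : ℂ) R, ENNReal.ofReal (g.normDeriv f z ^ 2)) /
    ENNReal.ofReal (Real.pi * R ^ 2)) atTop

/-- The holomorphic capacity `ρ(X, ω) = sup {ρ(f) | f ∈ 𝓜(X, ω)}`. -/
def HermitianMetric.capacity (g : HermitianMetric n X) : ℝ≥0∞ :=
  ⨆ f ∈ g.moduli, g.packingDensity f

end capacity

/-! ## Restriction of a Hermitian metric to an open subset -/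

section restrict

variable {n : ℕ} {X : Type*} [TopologicalSpace X] [ChartedSpace (EuclideanSpace ℂ (Fin n)) X]

theorem mdifferentiableAt_opens_val (U : TopologicalSpace.Opens X) (x : U) :
    MDifferentiableAt 𝓘(ℂ, EuclideanSpace ℂ (Fin n)) 𝓘(ℂ, EuclideanSpace ℂ (Fin n))
      (Subtype.val : U → X) x :=
  (contMDiff_subtype_val (n := 1) x).mdifferentiableAt one_ne_zero

variable [IsManifold 𝓘(ℂ, EuclideanSpace ℂ (Fin n)) ω X]

theorem mfderiv_opens_val_injective (U : TopologicalSpace.Opens X) (x : U) :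
    Function.Injective (mfderiv 𝓘(ℂ, EuclideanSpace ℂ (Fin n)) 𝓘(ℂ, EuclideanSpace ℂ (Fin n))
      (Subtype.val : U → X) x) := by
  have h1 : IsManifold 𝓘(ℂ, EuclideanSpace ℂ (Fin n)) 1 X := IsManifold.of_le (n := ω) le_top
  have hi := (mdifferentiable_chart (I := 𝓘(ℂ, EuclideanSpace ℂ (Fin n))) x).mfderiv_injective
    (mem_chart_source _ x)
  have hc : mfderiv 𝓘(ℂ, EuclideanSpace ℂ (Fin n)) 𝓘(ℂ, EuclideanSpace ℂ (Fin n))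
      (chartAt (EuclideanSpace ℂ (Fin n)) x) x = _ :=
    mfderiv_comp (I := 𝓘(ℂ, EuclideanSpace ℂ (Fin n))) (I' := 𝓘(ℂ, EuclideanSpace ℂ (Fin n)))
      (I'' := 𝓘(ℂ, EuclideanSpace ℂ (Fin n))) (f := (Subtype.val : U → X))
      (g := chartAt (EuclideanSpace ℂ (Fin n)) (x : X)) x
      (mdifferentiableAt_atlas (chart_mem_atlas _ _) (mem_chart_source _ _))
      (mdifferentiableAt_opens_val U x)
  rw [hc] at hi
  exact Function.Injective.of_comp (f := mfderiv 𝓘(ℂ, EuclideanSpace ℂ (Fin n))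
    𝓘(ℂ, EuclideanSpace ℂ (Fin n)) (chartAt (EuclideanSpace ℂ (Fin n)) (x : X)) (x : X)) hi

theorem mfderiv_opens_val_chart_symm (U : TopologicalSpace.Opens X) [hU : Nonempty U]
    (e : OpenPartialHomeomorph X (EuclideanSpace ℂ (Fin n)))
    (he : e.subtypeRestr hU ∈ atlas (EuclideanSpace ℂ (Fin n)) U)
    (x : EuclideanSpace ℂ (Fin n)) (hx : x ∈ (e.subtypeRestr hU).target)
    (u : EuclideanSpace ℂ (Fin n)) :
    (mfderiv 𝓘(ℂ, EuclideanSpace ℂ (Fin n)) 𝓘(ℂ, EuclideanSpace ℂ (Fin n)) (Subtype.val : U → X)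
      ((e.subtypeRestr hU).symm x) (mfderiv 𝓘(ℂ, EuclideanSpace ℂ (Fin n))
        𝓘(ℂ, EuclideanSpace ℂ (Fin n)) (e.subtypeRestr hU).symm x u) : EuclideanSpace ℂ (Fin n)) =
    mfderiv 𝓘(ℂ, EuclideanSpace ℂ (Fin n)) 𝓘(ℂ, EuclideanSpace ℂ (Fin n)) e.symm x u := by
  have h1 : IsManifold 𝓘(ℂ, EuclideanSpace ℂ (Fin n)) 1 U := IsManifold.of_le (n := ω) le_top
  have hc := mfderiv_comp (I := 𝓘(ℂ, EuclideanSpace ℂ (Fin n)))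
    (I' := 𝓘(ℂ, EuclideanSpace ℂ (Fin n))) (I'' := 𝓘(ℂ, EuclideanSpace ℂ (Fin n)))
    (f := (e.subtypeRestr hU).symm) (g := (Subtype.val : U → X)) x
    (mdifferentiableAt_opens_val U _) (mdifferentiableAt_atlas_symm he hx)
  have heq : (Subtype.val ∘ (e.subtypeRestr hU).symm : EuclideanSpace ℂ (Fin n) → X) =ᶠ[nhds x]
      e.symm :=
    Filter.eventuallyEq_of_mem ((e.subtypeRestr hU).open_target.mem_nhds hx)
      fun y hy => e.subtypeRestr_symm_apply hU hy
  rw [heq.mfderiv_eq] at hc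
  exact (DFunLike.congr_fun hc u).symm

/-- The restriction of a Hermitian metric to an open subset, i.e. its pull-back under the inclusion. -/
def HermitianMetric.restrict (g : HermitianMetric n X) (U : TopologicalSpace.Opens X) :
    HermitianMetric n U where
  inner p u v := g.inner (p : X)
    (mfderiv 𝓘(ℂ, EuclideanSpace ℂ (Fin n)) 𝓘(ℂ, EuclideanSpace ℂ (Fin n))
      (Subtype.val : U → X) p u)
    (mfderiv 𝓘(ℂ, EuclideanSpace ℂ (Fin n)) 𝓘(ℂ, EuclideanSpace ℂ (Fin n))
      (Subtype.val : U → X) p v)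
  add_left p u u' v := by rw [map_add]; exact g.add_left _ _ _ _
  smul_left p r u v := by rw [map_smul]; exact g.smul_left _ _ _ _
  symm p u v := g.symm _ _ _
  pos p u hu := g.pos _ _ fun h => hu (mfderiv_opens_val_injective U p (h.trans (map_zero _).symm))
  compat p u v := by rw [map_smul, map_smul]; exact g.compat _ _ _
  smooth e he u v := by
    obtain ⟨x₀, hx₀⟩ := Set.mem_iUnion.1 he
    have hU : Nonempty U := ⟨x₀⟩
    obtain rfl : e = (chartAt (EuclideanSpace ℂ (Fin n)) (x₀ : X)).subtypeRestr hU := hx₀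
    refine ((g.smooth _ (chart_mem_atlas _ (x₀ : X)) u v).mono
      (OpenPartialHomeomorph.subtypeRestr_target_subset _ hU)).congr fun x hx => ?_
    have hp := (chartAt (EuclideanSpace ℂ (Fin n)) (x₀ : X)).subtypeRestr_symm_apply hU hx
    have key : ∀ (p q : X) (_ : p = q) (a b a' b' : EuclideanSpace ℂ (Fin n)),
        a = a' → b = b' → g.inner p a b = g.inner q a' b' := by
      rintro p q rfl a b a' b' rfl rfl; rfl
    exact key _ _ hp _ _ _ _
      (mfderiv_opens_val_chart_symm U _ he x hx u) (mfderiv_opens_val_chart_symm U _ he x hx v)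

end restrict

/-! ## The complex projective space as a complex manifold -/

/-- The complex projective space `ℂPⁿ`, the space of lines in `ℂⁿ⁺¹`. -/
def CProj (n : ℕ) : Type := Projectivization ℂ (EuclideanSpace ℂ (Fin (n + 1)))

namespace CProj

variable {n : ℕ}

/-- The point with homogeneous coordinates `Z`. -/
def mk (Z : EuclideanSpace ℂ (Fin (n + 1))) (hZ : Z ≠ 0) : CProj n := Projectivization.mk ℂ Z hZ

/-- Homogeneous coordinates of a point. -/
def rep (p : CProj n) : EuclideanSpace ℂ (Fin (n + 1)) := Projectivization.rep p

theorem rep_ne_zero (p : CProj n) : p.rep ≠ 0 := Projectivization.rep_nonzero p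

theorem mk_rep (p : CProj n) : mk p.rep p.rep_ne_zero = p := Projectivization.mk_rep p

theorem mk_eq_mk {Z W : EuclideanSpace ℂ (Fin (n + 1))} (hZ : Z ≠ 0) (hW : W ≠ 0) (a : ℂ)
    (h : a • W = Z) : mk Z hZ = mk W hW :=
  (Projectivization.mk_eq_mk_iff' ℂ Z W hZ hW).2 ⟨a, h⟩

theorem exists_rep_mk (Z : EuclideanSpace ℂ (Fin (n + 1))) (hZ : Z ≠ 0) :
    ∃ a : ℂ, a ≠ 0 ∧ (mk Z hZ).rep = a • Z := by
  obtain ⟨a, ha⟩ := Projectivization.exists_smul_eq_mk_rep ℂ Z hZ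
  exact ⟨a, a.ne_zero, ha.symm⟩

/-- The quotient topology of `ℂⁿ⁺¹ ∖ {0}`. -/
instance : TopologicalSpace (CProj n) :=
  TopologicalSpace.coinduced
    (fun Z : {Z : EuclideanSpace ℂ (Fin (n + 1)) // Z ≠ 0} => mk Z.1 Z.2) inferInstance

theorem isQuotientMap_mk : Topology.IsQuotientMap
    (fun Z : {Z : EuclideanSpace ℂ (Fin (n + 1)) // Z ≠ 0} => mk Z.1 Z.2) :=
  ⟨⟨rfl⟩, fun p => ⟨⟨p.rep, p.rep_ne_zero⟩, p.mk_rep⟩⟩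

/-- The linear map `ℂⁿ → ℂⁿ⁺¹` which inserts a `0` in position `i`. -/
def ins (i : Fin (n + 1)) : EuclideanSpace ℂ (Fin n) →L[ℂ] EuclideanSpace ℂ (Fin (n + 1)) :=
  LinearMap.toContinuousLinearMap
    { toFun := fun w => WithLp.toLp 2 (i.insertNth (α := fun _ => ℂ) 0 w.ofLp)
      map_add' := fun v w => by
        ext j; refine i.succAboveCases ?_ (fun k => ?_) j <;> simp
      map_smul' := fun c w => by
        ext j; refine i.succAboveCases ?_ (fun k => ?_) j <;> simp }

/-- The linear map `ℂⁿ⁺¹ → ℂⁿ` which forgets the coordinate number `i`. -/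
def del (i : Fin (n + 1)) : EuclideanSpace ℂ (Fin (n + 1)) →L[ℂ] EuclideanSpace ℂ (Fin n) :=
  LinearMap.toContinuousLinearMap
    { toFun := fun Z => WithLp.toLp 2 fun j => Z (i.succAbove j)
      map_add' := fun v w => by ext j; simp
      map_smul' := fun c w => by ext j; simp }

@[simp] theorem ins_apply_self (i : Fin (n + 1)) (w : EuclideanSpace ℂ (Fin n)) :
    ins i w i = 0 := by simp [ins]

@[simp] theorem ins_apply_succAbove (i : Fin (n + 1)) (w : EuclideanSpace ℂ (Fin n)) (j : Fin n) :
    ins i w (i.succAbove j) = w j := by simp [ins]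

@[simp] theorem del_apply (i : Fin (n + 1)) (Z : EuclideanSpace ℂ (Fin (n + 1))) (j : Fin n) :
    del i Z j = Z (i.succAbove j) := by simp [del]

/-- The vector `(w₁, …, 1, …, wₙ)` of `ℂⁿ⁺¹` with the `1` in position `i`. -/
def lift (i : Fin (n + 1)) (w : EuclideanSpace ℂ (Fin n)) : EuclideanSpace ℂ (Fin (n + 1)) :=
  ins i w + EuclideanSpace.single i 1

@[simp] theorem lift_apply_self (i : Fin (n + 1)) (w : EuclideanSpace ℂ (Fin n)) :
    lift i w i = 1 := by simp [lift]

@[simp] theorem lift_apply_succAbove (i : Fin (n + 1)) (w : EuclideanSpace ℂ (Fin n)) (j : Fin n) :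
    lift i w (i.succAbove j) = w j := by simp [lift, Fin.succAbove_ne]

theorem lift_ne_zero (i : Fin (n + 1)) (w : EuclideanSpace ℂ (Fin n)) : lift i w ≠ 0 := fun h => by
  simpa using congrArg (fun Z => Z i) h

@[simp] theorem del_lift (i : Fin (n + 1)) (w : EuclideanSpace ℂ (Fin n)) :
    del i (lift i w) = w := by ext j; simp

theorem lift_del (i : Fin (n + 1)) (Z : EuclideanSpace ℂ (Fin (n + 1))) (hZ : Z i ≠ 0) :
    lift i ((Z i)⁻¹ • del i Z) = (Z i)⁻¹ • Z := by
  ext j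
  refine i.succAboveCases ?_ (fun k => ?_) j <;> simp [hZ]

/-- The affine coordinates `(z₀ / zᵢ, …, zₙ / zᵢ)`, with `zᵢ / zᵢ` left out, of a point
`[z₀ : … : zₙ]` such that `zᵢ ≠ 0`. -/
def coord (i : Fin (n + 1)) (p : CProj n) : EuclideanSpace ℂ (Fin n) := (p.rep i)⁻¹ • del i p.rep

theorem coord_mk (i : Fin (n + 1)) (Z : EuclideanSpace ℂ (Fin (n + 1))) (hZ : Z ≠ 0) :
    coord i (mk Z hZ) = (Z i)⁻¹ • del i Z := by
  obtain ⟨a, ha, h⟩ := exists_rep_mk Z hZ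
  simp only [coord, h, map_smul, smul_smul]
  congr 1
  simp only [PiLp.smul_apply, smul_eq_mul, mul_inv]
  field_simp

theorem rep_mk_apply_ne_zero (i : Fin (n + 1)) (Z : EuclideanSpace ℂ (Fin (n + 1))) (hZ : Z ≠ 0) :
    (mk Z hZ).rep i ≠ 0 ↔ Z i ≠ 0 := by
  obtain ⟨a, ha, h⟩ := exists_rep_mk Z hZ
  simp [h, ha]

theorem isOpen_source (i : Fin (n + 1)) : IsOpen {p : CProj n | p.rep i ≠ 0} := by
  rw [← isQuotientMap_mk.isOpen_preimage]
  simp only [Set.preimage_ofPred_eq, rep_mk_apply_ne_zero]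
  exact isOpen_ne_fun (by fun_prop) continuous_const

/-- The affine chart `[z₀ : … : zₙ] ↦ (z₀ / zᵢ, …, zₙ / zᵢ)` on `{zᵢ ≠ 0}`. -/
def chart (i : Fin (n + 1)) : OpenPartialHomeomorph (CProj n) (EuclideanSpace ℂ (Fin n)) where
  toFun := coord i
  invFun w := mk (lift i w) (lift_ne_zero i w)
  source := {p | p.rep i ≠ 0}
  target := Set.univ
  map_source' _ _ := Set.mem_univ _
  map_target' w _ := by simp [rep_mk_apply_ne_zero]
  left_inv' p hp := by
    conv_rhs => rw [← p.mk_rep]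
    exact mk_eq_mk _ _ (p.rep i)⁻¹ (lift_del i p.rep hp).symm
  right_inv' w _ := by rw [coord_mk]; simp
  open_source := isOpen_source i
  open_target := isOpen_univ
  continuousOn_toFun := by
    rw [isQuotientMap_mk.continuousOn_isOpen_iff (isOpen_source i)]
    have : ContinuousOn (fun Z : {Z : EuclideanSpace ℂ (Fin (n + 1)) // Z ≠ 0} =>
        (Z.1 i)⁻¹ • del i Z.1) {Z | Z.1 i ≠ 0} :=
      ContinuousOn.smul (ContinuousOn.inv₀ (by fun_prop) fun Z hZ => hZ) (by fun_prop)
    refine (this.mono fun Z hZ => ?_).congr fun Z _ => coord_mk i Z.1 Z.2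
    exact (rep_mk_apply_ne_zero i Z.1 Z.2).1 hZ
  continuousOn_invFun := by
    refine Continuous.continuousOn ?_
    exact isQuotientMap_mk.continuous.comp
      (Continuous.subtype_mk ((ins i).continuous.add continuous_const) fun w => lift_ne_zero i w)

theorem exists_rep_apply_ne_zero (p : CProj n) : ∃ i, p.rep i ≠ 0 := by
  by_contra! h
  exact p.rep_ne_zero (by ext i; simpa using h i)

/-- The atlas of the `n + 1` affine charts. -/
instance : ChartedSpace (EuclideanSpace ℂ (Fin n)) (CProj n) where
  atlas := Set.range chart
  chartAt p := chart p.exists_rep_apply_ne_zero.choose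
  mem_chart_source p := p.exists_rep_apply_ne_zero.choose_spec
  chart_mem_atlas _ := Set.mem_range_self _

theorem chart_mem_atlas (i : Fin (n + 1)) : chart i ∈ atlas (EuclideanSpace ℂ (Fin n)) (CProj n) :=
  Set.mem_range_self i

theorem chart_trans_apply (i k : Fin (n + 1)) (w : EuclideanSpace ℂ (Fin n)) :
    chart i ((chart k).symm w) = (lift k w i)⁻¹ • del i (lift k w) :=
  coord_mk i (lift k w) (lift_ne_zero k w)

theorem chart_symm_mem_source (i k : Fin (n + 1)) (w : EuclideanSpace ℂ (Fin n)) :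
    (chart k).symm w ∈ (chart i).source ↔ lift k w i ≠ 0 :=
  rep_mk_apply_ne_zero i (lift k w) (lift_ne_zero k w)

theorem contDiff_lift (k : Fin (n + 1)) {m : WithTop ℕ∞} : ContDiff ℂ m (lift k) :=
  (ins k).contDiff.add contDiff_const

instance : IsManifold 𝓘(ℂ, EuclideanSpace ℂ (Fin n)) ω (CProj n) := by
  refine isManifold_of_contDiffOn _ _ _ ?_
  rintro _ _ ⟨k, rfl⟩ ⟨i, rfl⟩
  have h : ContDiffOn ℂ ω (fun w => (lift k w i)⁻¹ • del i (lift k w)) {w | lift k w i ≠ 0} := by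
    have h2 : ContDiff ℂ ω fun w => lift k w i :=
      (EuclideanSpace.proj (𝕜 := ℂ) i).contDiff.comp (contDiff_lift k)
    exact (h2.contDiffOn.inv fun w hw => hw).smul
      ((del i).contDiff.comp (contDiff_lift k)).contDiffOn
  refine (h.mono fun w hw => ?_).congr fun w _ => chart_trans_apply i k w
  simp only [OpenPartialHomeomorph.trans_source, modelWithCornersSelf_coe_symm,
    Set.preimage_id_eq, id_eq, modelWithCornersSelf_coe, Set.range_id, Set.inter_univ,
    Set.mem_inter_iff, Set.mem_preimage] at hw
  exact (chart_symm_mem_source i k w).1 hw.2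

/-! ## The Fubini–Study metric -/

/-- The Fubini–Study metric in affine coordinates `w`: the real part of the Hermitian form
`π⁻¹ ∑ (∂²/∂wᵢ∂w̄ⱼ) log (1 + ‖w‖²) uᵢ v̄ⱼ`, whose fundamental form is
`(√-1 / 2π) ∂∂̄ log (1 + ‖w‖²)`. -/
def fsCoord (w u v : EuclideanSpace ℂ (Fin n)) : ℝ :=
  Real.pi⁻¹ * (((1 + ‖w‖ ^ 2 : ℝ) : ℂ) * ⟪u, v⟫_ℂ - ⟪u, w⟫_ℂ * ⟪w, v⟫_ℂ).re / (1 + ‖w‖ ^ 2) ^ 2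

/-- `fsCoord` is given by the complex Hessian of `log (1 + ‖w‖²)`: on the diagonal,
`∑ (∂²φ/∂wᵢ∂w̄ⱼ) uᵢ ūⱼ = (1/4) (∂ₜ² φ(w + t u) + ∂ₜ² φ(w + t i u))` at `t = 0`. -/
theorem fsCoord_self_eq_hessian (w u : EuclideanSpace ℂ (Fin n)) :
    fsCoord w u u = Real.pi⁻¹ * (1 / 4 *
      (deriv (deriv fun t : ℝ => Real.log (1 + ‖w + (t : ℂ) • u‖ ^ 2)) 0 +
        deriv (deriv fun t : ℝ => Real.log (1 + ‖w + (t : ℂ) • Complex.I • u‖ ^ 2)) 0)) := by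
  have hq : ∀ x : EuclideanSpace ℂ (Fin n),
      deriv (deriv fun t : ℝ => Real.log (1 + ‖w + (t : ℂ) • x‖ ^ 2)) 0 =
      (2 * ‖x‖ ^ 2 * (1 + ‖w‖ ^ 2) - 4 * (⟪w, x⟫_ℂ).re ^ 2) / (1 + ‖w‖ ^ 2) ^ 2 := by
    intro x
    have e1 : (fun t : ℝ => Real.log (1 + ‖w + (t : ℂ) • x‖ ^ 2)) =
        fun t : ℝ => Real.log (1 + ‖w‖ ^ 2 + 2 * (⟪w, x⟫_ℂ).re * t + ‖x‖ ^ 2 * t ^ 2) := by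
      funext t
      rw [norm_add_sq (𝕜 := ℂ), norm_smul, inner_smul_right]
      simp [mul_pow]
      ring_nf
    have hpos : ∀ t : ℝ, 0 < 1 + ‖w‖ ^ 2 + 2 * (⟪w, x⟫_ℂ).re * t + ‖x‖ ^ 2 * t ^ 2 := by
      intro t
      have : 1 + ‖w‖ ^ 2 + 2 * (⟪w, x⟫_ℂ).re * t + ‖x‖ ^ 2 * t ^ 2 =
          1 + ‖w + (t : ℂ) • x‖ ^ 2 := by
        rw [norm_add_sq (𝕜 := ℂ), norm_smul, inner_smul_right]
        simp [mul_pow]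
        ring_nf
      rw [this]; positivity
    have hq : ∀ t : ℝ, HasDerivAt
        (fun t : ℝ => 1 + ‖w‖ ^ 2 + 2 * (⟪w, x⟫_ℂ).re * t + ‖x‖ ^ 2 * t ^ 2)
        (2 * (⟪w, x⟫_ℂ).re + ‖x‖ ^ 2 * (2 * t)) t := by
      intro t
      have h := (((hasDerivAt_id t).const_mul (2 * (⟪w, x⟫_ℂ).re)).const_add (1 + ‖w‖ ^ 2)).add
        ((hasDerivAt_pow 2 t).const_mul (‖x‖ ^ 2))
      refine h.congr_deriv ?_
      simp
    have e2 := fun t => ((hq t).log (hpos t).ne').deriv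
    rw [e1, funext e2]
    have hn : HasDerivAt (fun t : ℝ => 2 * (⟪w, x⟫_ℂ).re + ‖x‖ ^ 2 * (2 * t)) (‖x‖ ^ 2 * 2) 0 := by
      simpa using (((hasDerivAt_id (0 : ℝ)).const_mul 2).const_mul (‖x‖ ^ 2)).const_add
        (2 * (⟪w, x⟫_ℂ).re)
    refine (hn.div (hq 0) (hpos 0).ne').deriv.trans ?_
    simp only [mul_zero, add_zero, ne_eq, OfNat.ofNat_ne_zero, not_false_eq_true, zero_pow]
    ring
  have e : ‖Complex.I • u‖ = ‖u‖ := by simp [norm_smul]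
  have e4 : ⟪u, w⟫_ℂ = (starRingEnd ℂ) ⟪w, u⟫_ℂ := (inner_conj_symm u w).symm
  rw [hq, hq, e, fsCoord, inner_smul_right, inner_self_eq_norm_sq_to_K, e4, mul_comm ((starRingEnd ℂ) _),
    Complex.mul_conj, Complex.normSq_apply]
  have h2 : ((((1 + ‖w‖ ^ 2 : ℝ) : ℂ) * ((‖u‖ : ℝ) : ℂ) ^ 2) -
      (((⟪w, u⟫_ℂ).re * (⟪w, u⟫_ℂ).re + (⟪w, u⟫_ℂ).im * (⟪w, u⟫_ℂ).im : ℝ) : ℂ)).re =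
      (1 + ‖w‖ ^ 2) * ‖u‖ ^ 2 -
        ((⟪w, u⟫_ℂ).re * (⟪w, u⟫_ℂ).re + (⟪w, u⟫_ℂ).im * (⟪w, u⟫_ℂ).im) := by
    norm_cast
  have h3 : (Complex.I * ⟪w, u⟫_ℂ).re = -(⟪w, u⟫_ℂ).im := by simp
  erw [h2]
  rw [h3]
  ring

/-- The expression of the Fubini–Study metric in homogeneous coordinates. -/
def fsHom (Z U V : EuclideanSpace ℂ (Fin (n + 1))) : ℝ :=
  Real.pi⁻¹ * (((‖Z‖ ^ 2 : ℝ) : ℂ) * ⟪U, V⟫_ℂ - ⟪U, Z⟫_ℂ * ⟪Z, V⟫_ℂ).re / (‖Z‖ ^ 2) ^ 2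

theorem inner_ins (i : Fin (n + 1)) (u v : EuclideanSpace ℂ (Fin n)) :
    ⟪ins i u, ins i v⟫_ℂ = ⟪u, v⟫_ℂ := by
  simp [PiLp.inner_apply, Fin.sum_univ_succAbove _ i]

theorem inner_ins_lift (i : Fin (n + 1)) (u w : EuclideanSpace ℂ (Fin n)) :
    ⟪ins i u, lift i w⟫_ℂ = ⟪u, w⟫_ℂ := by
  simp [PiLp.inner_apply, Fin.sum_univ_succAbove _ i]

theorem inner_lift_ins (i : Fin (n + 1)) (u w : EuclideanSpace ℂ (Fin n)) :
    ⟪lift i w, ins i u⟫_ℂ = ⟪w, u⟫_ℂ := by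
  simp [PiLp.inner_apply, Fin.sum_univ_succAbove _ i]

theorem norm_lift_sq (i : Fin (n + 1)) (w : EuclideanSpace ℂ (Fin n)) :
    ‖lift i w‖ ^ 2 = 1 + ‖w‖ ^ 2 := by
  simp [EuclideanSpace.norm_sq_eq, Fin.sum_univ_succAbove _ i]

theorem fsHom_lift (i : Fin (n + 1)) (w u v : EuclideanSpace ℂ (Fin n)) :
    fsHom (lift i w) (ins i u) (ins i v) = fsCoord w u v := by
  rw [fsHom, fsCoord, inner_ins, inner_ins_lift, inner_lift_ins, norm_lift_sq]

theorem fsHom_smul_add (Z U V : EuclideanSpace ℂ (Fin (n + 1))) (c a b : ℂ) (hc : c ≠ 0) :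
    fsHom (c • Z) (c • U + a • Z) (c • V + b • Z) = fsHom Z U V := by
  have hZ : ⟪Z, Z⟫_ℂ = ((‖Z‖ ^ 2 : ℝ) : ℂ) := by
    rw [inner_self_eq_norm_sq_to_K]; norm_cast
  have hcc : (((‖c‖ * ‖Z‖) ^ 2 : ℝ) : ℂ) = c * (starRingEnd ℂ) c * ((‖Z‖ ^ 2 : ℝ) : ℂ) := by
    rw [Complex.mul_conj, Complex.normSq_eq_norm_sq]; push_cast; ring
  have hc' : ‖c‖ ^ 2 ≠ 0 := by positivity
  have key : (((‖c‖ * ‖Z‖) ^ 2 : ℝ) : ℂ) * ⟪c • U + a • Z, c • V + b • Z⟫_ℂ -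
      ⟪c • U + a • Z, c • Z⟫_ℂ * ⟪c • Z, c • V + b • Z⟫_ℂ =
      (((‖c‖ ^ 2) ^ 2 : ℝ) : ℂ) * (((‖Z‖ ^ 2 : ℝ) : ℂ) * ⟪U, V⟫_ℂ - ⟪U, Z⟫_ℂ * ⟪Z, V⟫_ℂ) := by
    have : (((‖c‖ ^ 2) ^ 2 : ℝ) : ℂ) = (c * (starRingEnd ℂ) c) ^ 2 := by
      rw [Complex.mul_conj, Complex.normSq_eq_norm_sq]; push_cast; ring
    rw [hcc, this]
    simp only [inner_add_left, inner_add_right, inner_smul_left, inner_smul_right, hZ]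
    ring
  rw [fsHom, fsHom, norm_smul, key, Complex.re_ofReal_mul, mul_pow, mul_pow, mul_left_comm,
    mul_div_mul_left _ _ (pow_ne_zero 2 hc')]

/-- The coordinate expression of the Fubini–Study metric is invariant under changes of charts. -/
theorem fsCoord_chart_trans (i k : Fin (n + 1)) (w u v : EuclideanSpace ℂ (Fin n))
    (hw : lift k w i ≠ 0) (T : EuclideanSpace ℂ (Fin n) →L[ℂ] EuclideanSpace ℂ (Fin n))
    (hT : HasFDerivAt (fun x => chart i ((chart k).symm x)) T w) :
    fsCoord (chart i ((chart k).symm w)) (T u) (T v) = fsCoord w u v := by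
  have hl : HasFDerivAt (lift k) (ins k) w := (ins k).hasFDerivAt.add_const _
  have hc : HasFDerivAt (fun x => lift k x i) ((EuclideanSpace.proj i).comp (ins k)) w :=
    (EuclideanSpace.proj (𝕜 := ℂ) i).hasFDerivAt.comp w hl
  have hci := (hasDerivAt_inv hw).comp_hasFDerivAt w hc
  have h1 := hci.smul hl
  have h2 : HasFDerivAt (fun x => lift i (chart i ((chart k).symm x))) ((ins i).comp T) w :=
    ((ins i).hasFDerivAt.comp w hT).add_const _
  have heq : (fun x => lift i (chart i ((chart k).symm x))) =ᶠ[nhds w]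
      (fun x => (lift k x i)⁻¹ • lift k x) := by
    filter_upwards [hc.continuousAt.eventually_ne hw] with x hx
    rw [chart_trans_apply, lift_del _ _ hx]
  have h3 := (h2.congr_of_eventuallyEq heq.symm).unique h1
  have h4 : ∀ x, ∃ a : ℂ, ins i (T x) = (lift k w i)⁻¹ • ins k x + a • lift k w := fun x =>
    ⟨_, DFunLike.congr_fun h3 x⟩
  obtain ⟨a, ha⟩ := h4 u
  obtain ⟨b, hb⟩ := h4 v
  have h5 : lift i (chart i ((chart k).symm w)) = (lift k w i)⁻¹ • lift k w := heq.self_of_nhds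
  rw [← fsHom_lift i, ha, hb, h5, fsHom_smul_add _ _ _ _ _ _ (inv_ne_zero hw), fsHom_lift]

theorem fsCoord_add_left (w u u' v : EuclideanSpace ℂ (Fin n)) :
    fsCoord w (u + u') v = fsCoord w u v + fsCoord w u' v := by
  simp only [fsCoord, inner_add_left, Complex.sub_re, Complex.re_ofReal_mul, Complex.add_re, add_mul]
  ring

theorem fsCoord_smul_left (w u v : EuclideanSpace ℂ (Fin n)) (r : ℝ) :
    fsCoord w ((r : ℂ) • u) v = r * fsCoord w u v := by
  simp only [fsCoord, inner_smul_left, Complex.conj_ofReal]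
  rw [mul_left_comm, mul_assoc, ← mul_sub, Complex.re_ofReal_mul]
  ring

theorem fsCoord_symm (w u v : EuclideanSpace ℂ (Fin n)) : fsCoord w u v = fsCoord w v u := by
  rw [fsCoord, ← Complex.conj_re, fsCoord]
  simp only [map_sub, map_mul, inner_conj_symm, Complex.conj_ofReal]
  rw [mul_comm ⟪w, u⟫_ℂ]

theorem fsCoord_pos (w u : EuclideanSpace ℂ (Fin n)) (hu : u ≠ 0) : 0 < fsCoord w u u := by
  have h : (((1 + ‖w‖ ^ 2 : ℝ) : ℂ) * ⟪u, u⟫_ℂ - ⟪u, w⟫_ℂ * ⟪w, u⟫_ℂ).re =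
      (1 + ‖w‖ ^ 2) * ‖u‖ ^ 2 - ‖⟪w, u⟫_ℂ‖ ^ 2 := by
    rw [← inner_conj_symm u w, ← Complex.normSq_eq_conj_mul_self, inner_self_eq_norm_sq_to_K,
      Complex.normSq_eq_norm_sq]
    simp only [Complex.coe_algebraMap, ← Complex.ofReal_pow, ← Complex.ofReal_mul,
      ← Complex.ofReal_sub, Complex.ofReal_re]
  have h2 : ‖⟪w, u⟫_ℂ‖ ^ 2 ≤ ‖w‖ ^ 2 * ‖u‖ ^ 2 := by
    rw [← mul_pow]; exact pow_le_pow_left₀ (norm_nonneg _) (norm_inner_le_norm w u) 2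
  have h3 : 0 < ‖u‖ ^ 2 := by positivity
  rw [fsCoord, h]
  have : 0 < (1 + ‖w‖ ^ 2) * ‖u‖ ^ 2 - ‖⟪w, u⟫_ℂ‖ ^ 2 := by linarith
  have := Real.pi_pos
  positivity

theorem fsCoord_I_smul (w u v : EuclideanSpace ℂ (Fin n)) :
    fsCoord w (Complex.I • u) (Complex.I • v) = fsCoord w u v := by
  simp only [fsCoord, inner_smul_left, inner_smul_right, Complex.conj_I]
  congr 3
  linear_combination (-(((1 + ‖w‖ ^ 2 : ℝ) : ℂ) * ⟪u, v⟫_ℂ) + ⟪u, w⟫_ℂ * ⟪w, v⟫_ℂ) * Complex.I_mul_I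

theorem contDiff_fsCoord (u v : EuclideanSpace ℂ (Fin n)) :
    ContDiff ℝ ∞ fun w : EuclideanSpace ℂ (Fin n) => fsCoord w u v := by
  have h : ContDiff ℝ ∞ fun w : EuclideanSpace ℂ (Fin n) => (1 + ‖w‖ ^ 2 : ℝ) :=
    contDiff_const.add (contDiff_norm_sq ℂ)
  have h1 : ContDiff ℝ ∞ fun w : EuclideanSpace ℂ (Fin n) => ⟪u, w⟫_ℂ :=
    contDiff_const.inner ℂ contDiff_id
  have h2 : ContDiff ℝ ∞ fun w : EuclideanSpace ℂ (Fin n) => ⟪w, v⟫_ℂ :=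
    contDiff_id.inner ℂ contDiff_const
  unfold fsCoord
  refine (contDiff_const.mul (Complex.reCLM.contDiff.comp
    (((Complex.ofRealCLM.contDiff.comp h).mul contDiff_const).sub (h1.mul h2)))).div (h.pow 2)
    fun w => by positivity

/-- The Fubini–Study metric at `p`, evaluated in the chart `i`. -/
def fsChart (i : Fin (n + 1)) (p : CProj n)
    (u v : TangentSpace 𝓘(ℂ, EuclideanSpace ℂ (Fin n)) p) : ℝ :=
  fsCoord (chart i p)
    (mfderiv 𝓘(ℂ, EuclideanSpace ℂ (Fin n)) 𝓘(ℂ, EuclideanSpace ℂ (Fin n)) (chart i) p u)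
    (mfderiv 𝓘(ℂ, EuclideanSpace ℂ (Fin n)) 𝓘(ℂ, EuclideanSpace ℂ (Fin n)) (chart i) p v)

theorem fsChart_chart_symm (i k : Fin (n + 1)) (x : EuclideanSpace ℂ (Fin n))
    (hx : lift k x i ≠ 0) (u v : EuclideanSpace ℂ (Fin n)) :
    fsChart i ((chart k).symm x)
      (mfderiv 𝓘(ℂ, EuclideanSpace ℂ (Fin n)) 𝓘(ℂ, EuclideanSpace ℂ (Fin n)) (chart k).symm x u)
      (mfderiv 𝓘(ℂ, EuclideanSpace ℂ (Fin n)) 𝓘(ℂ, EuclideanSpace ℂ (Fin n)) (chart k).symm x v) =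
    fsCoord x u v := by
  have h1 : IsManifold 𝓘(ℂ, EuclideanSpace ℂ (Fin n)) 1 (CProj n) :=
    IsManifold.of_le (n := ω) le_top
  have hd := (mdifferentiableAt_atlas (I := 𝓘(ℂ, EuclideanSpace ℂ (Fin n))) (chart_mem_atlas i)
    ((chart_symm_mem_source i k x).2 hx)).hasMFDerivAt
  have hs := (mdifferentiableAt_atlas_symm (I := 𝓘(ℂ, EuclideanSpace ℂ (Fin n)))
    (chart_mem_atlas k) (Set.mem_univ x : x ∈ (chart k).target)).hasMFDerivAt
  have hc := (hd.comp x hs).hasFDerivAt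
  have := fsCoord_chart_trans i k x u v hx _ hc
  exact this

/-- The value of `fsChart` does not depend on the affine chart. -/
theorem fsChart_eq (i k : Fin (n + 1)) (p : CProj n) (hi : p ∈ (chart i).source)
    (hk : p ∈ (chart k).source) (u v : TangentSpace 𝓘(ℂ, EuclideanSpace ℂ (Fin n)) p) :
    fsChart i p u v = fsChart k p u v := by
  have h1 : IsManifold 𝓘(ℂ, EuclideanSpace ℂ (Fin n)) 1 (CProj n) :=
    IsManifold.of_le (n := ω) le_top
  have hM := mdifferentiable_of_mem_atlas (I := 𝓘(ℂ, EuclideanSpace ℂ (Fin n))) (chart_mem_atlas k)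
  obtain ⟨x, rfl⟩ : ∃ x, (chart k).symm x = p := ⟨chart k p, (chart k).left_inv hk⟩
  obtain ⟨u, rfl⟩ := (hM.symm.mfderiv_surjective (Set.mem_univ x : x ∈ (chart k).symm.source)) u
  obtain ⟨v, rfl⟩ := (hM.symm.mfderiv_surjective (Set.mem_univ x : x ∈ (chart k).symm.source)) v
  rw [fsChart_chart_symm i k x ((chart_symm_mem_source i k x).1 hi) u v,
    fsChart_chart_symm k k x ((chart_symm_mem_source k k x).1 hk) u v]

/-- The Fubini–Study metric on `ℂPⁿ`, with fundamental form `(√-1 / 2π) ∂∂̄ log (1 + ∑ |wⱼ|²)` in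
every affine chart. -/
def fubiniStudy (n : ℕ) : HermitianMetric n (CProj n) where
  inner p u v := fsChart p.exists_rep_apply_ne_zero.choose p u v
  add_left p u u' v := by unfold fsChart; rw [map_add]; exact fsCoord_add_left _ _ _ _
  smul_left p r u v := by unfold fsChart; rw [map_smul]; exact fsCoord_smul_left _ _ _ _
  symm p u v := fsCoord_symm _ _ _
  pos p u hu := by
    have h1 : IsManifold 𝓘(ℂ, EuclideanSpace ℂ (Fin n)) 1 (CProj n) :=
      IsManifold.of_le (n := ω) le_top
    refine fsCoord_pos _ _ fun h => hu ?_
    exact (mdifferentiable_of_mem_atlas (I := 𝓘(ℂ, EuclideanSpace ℂ (Fin n)))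
      (chart_mem_atlas _)).mfderiv_injective p.exists_rep_apply_ne_zero.choose_spec
        (h.trans (map_zero _).symm)
  compat p u v := by unfold fsChart; rw [map_smul, map_smul]; exact fsCoord_I_smul _ _ _
  smooth := by
    rintro _ ⟨k, rfl⟩ u v
    refine (contDiff_fsCoord u v).contDiffOn.congr fun x _ => fsChart_chart_symm _ k x ?_ u v
    exact (chart_symm_mem_source _ k x).1 ((chart k).symm x).exists_rep_apply_ne_zero.choose_spec

/-! ## Hyperplanes -/

/-- The hyperplane `∑ aⱼ zⱼ = 0` in `ℂPⁿ`. -/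
def hyperplane (a : Fin (n + 1) → ℂ) : Set (CProj n) := {p | ∑ j, a j * p.rep j = 0}

theorem mk_mem_hyperplane (a : Fin (n + 1) → ℂ) (Z : EuclideanSpace ℂ (Fin (n + 1))) (hZ : Z ≠ 0) :
    mk Z hZ ∈ hyperplane a ↔ ∑ j, a j * Z j = 0 := by
  obtain ⟨c, hc, h⟩ := exists_rep_mk Z hZ
  have : ∑ j, a j * (c • Z) j = c * ∑ j, a j * Z j := by
    rw [Finset.mul_sum]
    exact Finset.sum_congr rfl fun j _ => by simp; ring
  rw [hyperplane, Set.mem_ofPred_eq, h, this]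
  simp [hc]

theorem isClosed_hyperplane (a : Fin (n + 1) → ℂ) : IsClosed (hyperplane a) := by
  rw [← isQuotientMap_mk.isClosed_preimage]
  have : (fun Z : {Z : EuclideanSpace ℂ (Fin (n + 1)) // Z ≠ 0} => mk Z.1 Z.2) ⁻¹' hyperplane a =
      {Z | ∑ j, a j * Z.1 j = 0} := Set.ext fun Z => mk_mem_hyperplane a Z.1 Z.2
  rw [this]
  exact isClosed_eq (by fun_prop) continuous_const

/-- The complement of the hyperplanes `Hᵢ : ∑ aᵢⱼ zⱼ = 0`, as an open subset of `ℂPⁿ`. -/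
def hyperplaneComplement (A : Matrix (Fin (n + 1)) (Fin (n + 1)) ℂ) :
    TopologicalSpace.Opens (CProj n) where
  carrier := (⋃ i, hyperplane (A i))ᶜ
  is_open' := (isClosed_iUnion_of_finite fun i => isClosed_hyperplane (A i)).isOpen_compl

end CProj

end

/-! ## The Fubini–Study form in homogeneous coordinates -/

namespace CProj

variable {n : ℕ}

/-! Let `L i` be the linear form of row `i` of `A`. Along the curve each ratio `L i / L 0` is entire
without zeros, hence equal to `e^{g i}`. So `A` carries the curve to `[e^{g 0} : … : e^{g n}]` with
`Re (g 0) = 0`, and a linear change of homogeneous coordinates distorts the Fubini–Study metric only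
by bounded factors (`exists_fsHom_map_le`). It is therefore enough to study `V = (e^{g i})`.

Bounded derivative forces the `g i` to be polynomials of degree at most two. The energy density is,
up to a constant, the Laplacian of `log ‖V‖`, so a bound on it makes the circle means of `log ‖V‖`
grow at most like `r²` (`exists_circleAverage_log_norm_le`). Since `log ‖V‖` dominates both `Re (g
i)` and `Re (g 0) = 0`, the means of `(Re (g i))⁺` grow no faster. The Poisson formula turns this
into a pointwise bound, and Borel–Carathéodory with Cauchy's estimates removes all Taylor
coefficients from degree three on.

The density is at most a sum of terms `exp (-2 |Re (g i - g k)|) |g i' - g k'|²` (`fsHom_exp_le`).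
If `g i - g k` is constant its term vanishes. Otherwise `|Re (g i - g k)|` grows at least linearly
along almost every ray, and the exponential beats the polynomial factor. Rescaling the disc of
radius `R` to the unit disc, dominated convergence gives mean energy zero. -/

theorem fsHom_self (Z U : EuclideanSpace ℂ (Fin (n + 1))) :
    fsHom Z U U = Real.pi⁻¹ * (‖Z‖ ^ 2 * ‖U‖ ^ 2 - ‖⟪Z, U⟫_ℂ‖ ^ 2) / (‖Z‖ ^ 2) ^ 2 := by
  rw [fsHom, ← inner_conj_symm U Z, ← Complex.normSq_eq_conj_mul_self,
    inner_self_eq_norm_sq_to_K, Complex.normSq_eq_norm_sq]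
  simp only [Complex.coe_algebraMap, ← Complex.ofReal_pow, ← Complex.ofReal_mul,
    ← Complex.ofReal_sub, Complex.ofReal_re]

theorem fsHom_self_nonneg (Z U : EuclideanSpace ℂ (Fin (n + 1))) : 0 ≤ fsHom Z U U := by
  rw [fsHom_self]
  have h := pow_le_pow_left₀ (norm_nonneg _) (norm_inner_le_norm (𝕜 := ℂ) Z U) 2
  rw [mul_pow] at h
  have := Real.pi_pos
  have h2 := sub_nonneg.2 h
  positivity

theorem fsHom_sub_smul (Z U : EuclideanSpace ℂ (Fin (n + 1))) (a : ℂ) :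
    fsHom Z (U - a • Z) (U - a • Z) = fsHom Z U U := by
  have := fsHom_smul_add Z U U 1 (-a) (-a) one_ne_zero
  simpa [sub_eq_add_neg] using this

/-- Subtracting a multiple of `Z` does not change the form, and dropping the Gram term `‖⟪Z, ·⟫‖²`
only increases it. With the next lemma, `fsHom Z U U` is `π⁻¹` times the minimum over `a` of `‖U - a
• Z‖² / ‖Z‖²`. Later estimates come from a good choice of `a`. -/
theorem fsHom_self_le (Z U : EuclideanSpace ℂ (Fin (n + 1))) (hZ : Z ≠ 0) (a : ℂ) :
    fsHom Z U U ≤ Real.pi⁻¹ * (‖U - a • Z‖ ^ 2 / ‖Z‖ ^ 2) := by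
  rw [← fsHom_sub_smul Z U a, fsHom_self, mul_div_assoc]
  have hZ' : 0 < ‖Z‖ ^ 2 := by positivity
  have := Real.pi_pos
  refine mul_le_mul_of_nonneg_left ?_ (inv_nonneg.2 this.le)
  rw [div_le_div_iff₀ (by positivity) hZ']
  nlinarith [sq_nonneg ‖⟪Z, U - a • Z⟫_ℂ‖]

/-- The minimum is attained when `a • Z` is the orthogonal projection of `U` to the line of `Z`,
since the Gram term then vanishes. -/
theorem exists_fsHom_self_eq (Z U : EuclideanSpace ℂ (Fin (n + 1))) (hZ : Z ≠ 0) :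
    ∃ a : ℂ, fsHom Z U U = Real.pi⁻¹ * (‖U - a • Z‖ ^ 2 / ‖Z‖ ^ 2) := by
  have hZZ : ⟪Z, Z⟫_ℂ ≠ 0 := inner_self_ne_zero.2 hZ
  refine ⟨⟪Z, U⟫_ℂ / ⟪Z, Z⟫_ℂ, ?_⟩
  rw [← fsHom_sub_smul Z U (⟪Z, U⟫_ℂ / ⟪Z, Z⟫_ℂ), fsHom_self, inner_sub_right, inner_smul_right,
    div_mul_cancel₀ _ hZZ]
  have hZ' : ‖Z‖ ≠ 0 := norm_ne_zero_iff.2 hZ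
  simp only [sub_self, norm_zero]
  field_simp
  ring

/-- The Fubini–Study forms in two linear systems of homogeneous coordinates are comparable. -/
theorem exists_fsHom_map_le
    (B : EuclideanSpace ℂ (Fin (n + 1)) ≃L[ℂ] EuclideanSpace ℂ (Fin (n + 1))) :
    ∃ K : ℝ, 0 ≤ K ∧ ∀ Z U, Z ≠ 0 → fsHom (B Z) (B U) (B U) ≤ K * fsHom Z U U := by
  let S := (B.symm : EuclideanSpace ℂ (Fin (n + 1)) →L[ℂ] EuclideanSpace ℂ (Fin (n + 1)))
  let T := (B : EuclideanSpace ℂ (Fin (n + 1)) →L[ℂ] EuclideanSpace ℂ (Fin (n + 1)))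
  refine ⟨(‖T‖ * ‖S‖) ^ 2, by positivity, fun Z U hZ => ?_⟩
  obtain ⟨a, ha⟩ := exists_fsHom_self_eq Z U hZ
  have hBZ : B Z ≠ 0 := by simpa using hZ
  -- The `a` that is optimal for `(Z, U)` is a competitor for `(B Z, B U)`; only operator norms of
  -- `B` and its inverse remain to be compared.
  refine (fsHom_self_le (B Z) (B U) hBZ a).trans ?_
  rw [ha, ← map_smul, ← map_sub, mul_left_comm]
  have := Real.pi_pos
  gcongr
  have h1 : ‖B (U - a • Z)‖ ≤ ‖T‖ * ‖U - a • Z‖ := T.le_opNorm _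
  have h2 : ‖Z‖ ≤ ‖S‖ * ‖B Z‖ := by simpa [S] using S.le_opNorm (B Z)
  have hZ' : 0 < ‖Z‖ := norm_pos_iff.2 hZ
  have hBZ' : 0 < ‖B Z‖ := norm_pos_iff.2 hBZ
  rw [← mul_div_assoc, ← mul_pow, ← div_pow, ← div_pow]
  refine pow_le_pow_left₀ (by positivity) ?_ 2
  rw [div_le_div_iff₀ hBZ' hZ']
  calc ‖B (U - a • Z)‖ * ‖Z‖ ≤ (‖T‖ * ‖U - a • Z‖) * (‖S‖ * ‖B Z‖) := by gcongr
    _ = _ := by ring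

end CProj

/-! ## Entire functions whose real part has positive part of quadratic mean growth -/

/-- If the circle averages of `(Re h)⁺` grow at most quadratically, then so does `Re h`. -/
theorem re_le_of_circleAverage_posPart_le {h : ℂ → ℂ} (hh : Differentiable ℂ h) {K : ℝ}
    (hK : ∀ r : ℝ, 1 ≤ r → Real.circleAverage (fun z => max (h z).re 0) 0 r ≤ K * r ^ 2)
    {r : ℝ} (hr : 1 ≤ r) {w : ℂ} (hw : ‖w‖ ≤ r) : (h w).re ≤ 12 * K * r ^ 2 := by
  have hr0 : 0 < r := by linarith
  have hwR : w ∈ Metric.ball (0 : ℂ) (2 * r) := by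
    rw [mem_ball_zero_iff]; linarith
  -- The Poisson formula is used on the circle of radius `2 * r`, to keep `w` away from the
  -- boundary.
  have hP := hh.diffContOnCl (s := Metric.ball (0 : ℂ) (2 * r))
    |>.circleAverage_poissonKernel_smul hwR
  have hcont : ContinuousOn (poissonKernel 0 w) (Metric.sphere 0 |2 * r|) := by
    rw [poissonKernel_eq_re_herglotzRieszKernel]
    exact Complex.continuous_re.comp_continuousOn (continuousOn_herglotzRieszKernel_sphere hwR)
  have hre : Continuous fun z => (h z).re := Complex.continuous_re.comp hh.continuous
  have h1 : Real.circleAverage (fun z => poissonKernel 0 w z * (h z).re) 0 (2 * r) = (h w).re := by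
    have h2 := Complex.reCLM.circleAverage_comp_comm (f := poissonKernel 0 w • h) (c := 0)
      (R := 2 * r) (hcont.smul hh.continuous.continuousOn).circleIntegrable'
    rw [hP] at h2
    rw [Complex.reCLM_apply] at h2
    rw [← h2]
    congr 1
    ext z
    simp
  have h3 : Real.circleAverage (fun z => poissonKernel 0 w z * (h z).re) 0 (2 * r) ≤
      Real.circleAverage (fun z => (3 : ℝ) • max (h z).re 0) 0 (2 * r) := by
    refine Real.circleAverage_mono (hcont.mul hre.continuousOn).circleIntegrable'
      (by fun_prop : Continuous fun z => (3 : ℝ) • max (h z).re 0).continuousOn.circleIntegrable' fun z hz => ?_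
    rw [abs_of_pos (by linarith)] at hz
    -- The kernel is at most `(2r + ‖w‖) / (2r - ‖w‖) ≤ 3r / r`. The final constant is `12 = 3 *
    -- 2²`.
    have h4 : poissonKernel 0 w z ≤ 3 := by
      rw [poissonKernel_eq_re_herglotzRieszKernel]
      refine (re_herglotzRieszKernel_le hz hwR).trans ?_
      rw [sub_zero, div_le_iff₀ (by linarith)]
      linarith
    have h5 : 0 ≤ poissonKernel 0 w z := by
      rw [poissonKernel_eq_re_herglotzRieszKernel]
      refine le_trans ?_ (le_re_herglotzRieszKernel hz hwR)
      rw [sub_zero]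
      exact div_nonneg (by linarith) (by linarith [norm_nonneg w])
    calc poissonKernel 0 w z * (h z).re ≤ poissonKernel 0 w z * max (h z).re 0 := by
          gcongr; exact le_max_left _ _
      _ ≤ 3 * max (h z).re 0 := by gcongr
  rw [h1, Real.circleAverage_fun_smul, smul_eq_mul] at h3
  have := hK (2 * r) (by linarith)
  linarith

/-- An entire function whose real part is bounded above by a quadratic polynomial in `|z|` is a
polynomial of degree at most two. -/
theorem exists_eq_quadratic_of_re_le {h : ℂ → ℂ} (hh : Differentiable ℂ h) {K : ℝ}
    (hK : ∀ r : ℝ, 1 ≤ r → ∀ w : ℂ, ‖w‖ ≤ r → (h w).re ≤ K * r ^ 2) :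
    ∃ a b c : ℂ, ∀ z, h z = a * z ^ 2 + b * z + c := by
  have hit : ∀ k, 3 ≤ k → iteratedDeriv k h 0 = 0 := by
    intro k hk
    -- Borel–Carathéodory asks for a positive upper bound of the real part.
    set K' := max K 1
    have hb : ∀ r : ℝ, 1 ≤ r → ∀ z ∈ Metric.sphere (0 : ℂ) r,
        ‖h z‖ ≤ (8 * K' + 3 * ‖h 0‖) * r ^ 2 := by
      intro r hr z hz
      rw [mem_sphere_zero_iff_norm] at hz
      have hK' : 0 < K' * (2 * r) ^ 2 := by positivity
      have hB := Complex.borelCaratheodory (f := h) (z := z) (R := 2 * r) hK' hh.differentiableOn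
        (fun w hw => (hK (2 * r) (by linarith) w (mem_ball_zero_iff.1 hw).le).trans
          (mul_le_mul_of_nonneg_right (le_max_left _ _) (by positivity))) (by linarith)
        (by rw [mem_ball_zero_iff]; linarith)
      have e : 2 * (K' * (2 * r) ^ 2) * r / (2 * r - r) + ‖h 0‖ * (2 * r + r) / (2 * r - r) =
          8 * K' * r ^ 2 + 3 * ‖h 0‖ := by
        rw [show 2 * r - r = r by ring]; field_simp; ring
      rw [hz, e] at hB
      nlinarith [norm_nonneg (h 0), mul_nonneg (norm_nonneg (h 0)) (by nlinarith : 0 ≤ r ^ 2 - 1)]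
    set C := 8 * K' + 3 * ‖h 0‖
    have hC : 0 ≤ C := by positivity
    -- Cauchy's estimate gives `k! * C * r² / r ^ k`, which is at most `k! * C / r` because `k ≥ 3`.
    have hle : ∀ r : ℝ, 1 ≤ r → ‖iteratedDeriv k h 0‖ ≤ k.factorial * C / r := by
      intro r hr
      refine (Complex.norm_iteratedDeriv_le_of_forall_mem_sphere_norm_le k (by linarith)
        hh.diffContOnCl (hb r hr)).trans ?_
      rw [div_le_div_iff₀ (by positivity) (by positivity), ← mul_assoc, mul_assoc]
      refine mul_le_mul_of_nonneg_left ?_ (by positivity)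
      rw [← pow_succ]
      exact pow_le_pow_right₀ hr hk
    rw [← norm_le_zero_iff]
    have ht : Tendsto (fun r : ℝ => k.factorial * C / r) atTop (nhds 0) :=
      tendsto_const_nhds.div_atTop tendsto_id
    refine ge_of_tendsto ht ?_
    filter_upwards [eventually_ge_atTop 1] with r hr using hle r hr
  refine ⟨iteratedDeriv 2 h 0 / 2, iteratedDeriv 1 h 0, h 0, fun z => ?_⟩
  rw [← Complex.taylorSeries_eq_of_entire' 0 z hh, tsum_eq_sum (s := Finset.range 3)]
  · simp [Finset.sum_range_succ]
    ring
  · intro k hk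
    rw [hit k (by simpa using hk)]
    simp

/-! ## Growth of curves with bounded derivative -/

/-- Green's formula on a period strip: the circle integrals of a `2πi`-periodic function are
controlled by the integral of its `∂̄`-derivative. -/
theorem integral_period_re_sub {F : ℂ → ℂ} (hF : ContDiff ℝ 1 F)
    (hper : ∀ s, F (s + 2 * Real.pi * Complex.I) = F s) (a b : ℝ) :
    (∫ y in (0 : ℝ)..2 * Real.pi, (F (b + y * Complex.I)).re) -
      ∫ y in (0 : ℝ)..2 * Real.pi, (F (a + y * Complex.I)).re =
    ∫ x in a..b, ∫ y in (0 : ℝ)..2 * Real.pi,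
      (fderiv ℝ F (x + y * Complex.I) 1 + Complex.I * fderiv ℝ F (x + y * Complex.I) Complex.I).re := by
  have hd : Continuous (fderiv ℝ F) := hF.continuous_fderiv one_ne_zero
  have hcF : Continuous F := hF.continuous
  have h := Complex.integral_boundary_rect_of_hasFDerivAt_real_off_countable F (fderiv ℝ F) a
    (b + (2 * Real.pi : ℝ) * Complex.I) ∅ Set.countable_empty hF.continuous.continuousOn
    (fun x _ => (hF.differentiable one_ne_zero x).hasFDerivAt)
    (by
      refine ContinuousOn.integrableOn_compact (isCompact_uIcc.reProdIm isCompact_uIcc) ?_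
      fun_prop)
  simp only [Complex.ofReal_re, Complex.ofReal_im, Complex.add_re, Complex.mul_re, Complex.I_re,
    mul_zero, Complex.I_im, mul_one, sub_zero, Complex.add_im, Complex.mul_im, add_zero,
    zero_add, Complex.ofReal_zero, zero_mul, smul_eq_mul] at h
  -- The horizontal sides of the rectangle cancel by periodicity.
  have hp : (∫ x in a..b, F (x + ((2 * Real.pi : ℝ) : ℂ) * Complex.I)) = ∫ x in a..b, F x := by
    refine intervalIntegral.integral_congr fun x _ => ?_
    simpa using hper x
  rw [hp, sub_self, zero_add] at h
  have hre : ∀ c : ℝ, (∫ y in (0 : ℝ)..2 * Real.pi, (F (c + y * Complex.I)).re) =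
      (∫ y in (0 : ℝ)..2 * Real.pi, F (c + y * Complex.I)).re := fun c =>
    Complex.reCLM.intervalIntegral_comp_comm
      (Continuous.intervalIntegrable (by fun_prop) _ _)
  -- The vertical sides carry a factor `I`, so the real identity is the imaginary part of the
  -- rectangle formula.
  have hin : ∀ x : ℝ, (∫ y in (0 : ℝ)..2 * Real.pi, (fderiv ℝ F (x + y * Complex.I) 1 +
      Complex.I * fderiv ℝ F (x + y * Complex.I) Complex.I).re) =
      (∫ y in (0 : ℝ)..2 * Real.pi, (Complex.I * fderiv ℝ F (x + y * Complex.I) 1 -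
        fderiv ℝ F (x + y * Complex.I) Complex.I)).im := by
    intro x
    refine Eq.trans ?_ (Complex.imCLM.intervalIntegral_comp_comm
      (Continuous.intervalIntegrable (by fun_prop) _ _))
    refine intervalIntegral.integral_congr fun y _ => ?_
    simp [sub_eq_add_neg]
  rw [hre, hre, intervalIntegral.integral_congr fun x _ => hin x]
  have hc : Continuous fun x : ℝ => ∫ y in (0 : ℝ)..2 * Real.pi,
      (Complex.I * fderiv ℝ F (x + y * Complex.I) 1 -
        fderiv ℝ F (x + y * Complex.I) Complex.I) := by
    refine intervalIntegral.continuous_parametric_intervalIntegral_of_continuous' ?_ _ _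
    unfold Function.uncurry
    fun_prop
  have hout := Complex.imCLM.intervalIntegral_comp_comm (hc.intervalIntegrable (μ := volume) a b)
  simp only [Complex.imCLM_apply] at hout
  rw [hout, ← h]
  simp

theorem differentiable_deriv_of_entire {E : Type*} [NormedAddCommGroup E] [NormedSpace ℂ E]
    [CompleteSpace E] {Y : ℂ → E} (hY : Differentiable ℂ Y) : Differentiable ℂ (deriv Y) :=
  fun _ => ((hY.differentiableOn (s := Set.univ)).deriv isOpen_univ).differentiableAt
    Filter.univ_mem

/-! ### Complex derivatives of `log ‖Y‖²` for a holomorphic lift `Y`. -/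

section strip

variable {n : ℕ} {Y : ℂ → EuclideanSpace ℂ (Fin (n + 1))}

/-- Inner products of holomorphic vectors are only real differentiable; their derivatives in the
directions `1` and `I` are computed along real lines with this rule. -/
theorem hasDerivAt_line (hY : Differentiable ℂ Y) (z c : ℂ) :
    HasDerivAt (fun t : ℝ => Y (z + t • c)) (c • deriv Y z) 0 := by
  have h1 : HasDerivAt (fun t : ℝ => z + t • c) c 0 := by
    simpa using ((hasDerivAt_id (0 : ℝ)).smul_const c).const_add z
  have h2 : HasDerivAt Y (deriv Y z) (z + (0 : ℝ) • c) := by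
    simpa using (hY z).hasDerivAt
  exact h2.scomp (0 : ℝ) h1

theorem contDiff_real_of_differentiable (hY : Differentiable ℂ Y) : ContDiff ℝ 1 Y :=
  (hY.contDiff (n := 1)).restrict_scalars ℝ

theorem continuous_fsHom_deriv (hY : Differentiable ℂ Y) (hY0 : ∀ s, Y s ≠ 0) :
    Continuous fun s => CProj.fsHom (Y s) (deriv Y s) (deriv Y s) := by
  have h1 := hY.continuous
  have h2 := (differentiable_deriv_of_entire hY).continuous
  have h3 : ∀ s, (‖Y s‖ ^ 2) ^ 2 ≠ 0 := fun s => by simpa using hY0 s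
  simp only [CProj.fsHom_self]
  exact Continuous.div (by fun_prop) (by fun_prop) h3

/-- The quotient is `∂ log ‖Y‖²`, the inner product being linear in its second slot. -/
theorem contDiff_inner_deriv_div (hY : Differentiable ℂ Y) (hY0 : ∀ s, Y s ≠ 0) :
    ContDiff ℝ 1 fun s => ⟪Y s, deriv Y s⟫_ℂ / ⟪Y s, Y s⟫_ℂ := by
  have h1 := contDiff_real_of_differentiable hY
  have h2 := contDiff_real_of_differentiable (differentiable_deriv_of_entire hY)
  have h3 : ContDiff ℝ 1 fun s => ⟪Y s, deriv Y s⟫_ℂ := h1.inner ℂ h2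
  have h4 : ContDiff ℝ 1 fun s => ⟪Y s, Y s⟫_ℂ := h1.inner ℂ h1
  have h5 : ∀ s, ⟪Y s, Y s⟫_ℂ ≠ 0 := fun s => inner_self_ne_zero.2 (hY0 s)
  simp only [div_eq_mul_inv]
  exact h3.mul (h4.inv h5)

/-- The left side is the real part of `2 ∂̄F` with `F = ∂ log ‖Y‖²`, and `∂̄∂ log ‖Y‖²` is `π` times
the Fubini–Study density. The terms with the second derivative of `Y` cancel because `∂̄` kills
holomorphic factors. -/
theorem dbar_inner_deriv_div (hY : Differentiable ℂ Y) (hY0 : ∀ s, Y s ≠ 0) (s : ℂ) :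
    let F := fun s => ⟪Y s, deriv Y s⟫_ℂ / ⟪Y s, Y s⟫_ℂ
    (fderiv ℝ F s 1 + Complex.I * fderiv ℝ F s Complex.I).re =
      2 * Real.pi * CProj.fsHom (Y s) (deriv Y s) (deriv Y s) := by
  intro F
  have hdF := (contDiff_inner_deriv_div hY hY0).differentiable one_ne_zero s
  have hYY : ⟪Y s, Y s⟫_ℂ ≠ 0 := inner_self_ne_zero.2 (hY0 s)
  have hl : ∀ c : ℂ, fderiv ℝ F s c =
      ((⟪Y s, c • deriv (deriv Y) s⟫_ℂ + ⟪c • deriv Y s, deriv Y s⟫_ℂ) * ⟪Y s, Y s⟫_ℂ -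
        ⟪Y s, deriv Y s⟫_ℂ * (⟪Y s, c • deriv Y s⟫_ℂ + ⟪c • deriv Y s, Y s⟫_ℂ)) /
        ⟪Y s, Y s⟫_ℂ ^ 2 := by
    intro c
    have h1 := hasDerivAt_line hY s c
    have h2 := hasDerivAt_line (differentiable_deriv_of_entire hY) s c
    have h3 := (h1.inner ℂ h2).div (h1.inner ℂ h1) (by simpa using hYY)
    have h4 : HasLineDerivAt ℝ F _ s c := h3
    rw [← hdF.lineDeriv_eq_fderiv, h4.lineDeriv]
    simp only [zero_smul, add_zero]
  have hn : ⟪Y s, Y s⟫_ℂ = ((‖Y s‖ ^ 2 : ℝ) : ℂ) := by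
    rw [inner_self_eq_norm_sq_to_K]; norm_cast
  have key : fderiv ℝ F s 1 + Complex.I * fderiv ℝ F s Complex.I =
      ((2 / (‖Y s‖ ^ 2) ^ 2 : ℝ) : ℂ) * (((‖Y s‖ ^ 2 : ℝ) : ℂ) * ⟪deriv Y s, deriv Y s⟫_ℂ -
        ⟪deriv Y s, Y s⟫_ℂ * ⟪Y s, deriv Y s⟫_ℂ) := by
    rw [hl, hl]
    simp only [inner_smul_left, inner_smul_right, Complex.conj_I, map_one, one_mul]
    push_cast
    have : ((‖Y s‖ : ℝ) : ℂ) ^ 2 = ⟪Y s, Y s⟫_ℂ := by rw [hn]; push_cast; rfl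
    rw [this]
    field_simp
    linear_combination (⟪Y s, Y s⟫_ℂ * ⟪Y s, deriv (deriv Y) s⟫_ℂ -
      ⟪Y s, Y s⟫_ℂ * ⟪deriv Y s, deriv Y s⟫_ℂ - ⟪Y s, deriv Y s⟫_ℂ ^ 2 +
      ⟪Y s, deriv Y s⟫_ℂ * ⟪deriv Y s, Y s⟫_ℂ) * Complex.I_sq
  rw [key, Complex.re_ofReal_mul, CProj.fsHom]
  have := Real.pi_ne_zero
  field_simp

theorem contDiff_log_inner (hY : Differentiable ℂ Y) (hY0 : ∀ s, Y s ≠ 0) :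
    ContDiff ℝ 1 fun s => Real.log (⟪Y s, Y s⟫_ℂ).re := by
  have h1 := contDiff_real_of_differentiable hY
  refine (Complex.reCLM.contDiff.comp (h1.inner ℂ h1)).log fun s => ?_
  simpa [inner_self_eq_norm_sq_to_K, ← Complex.ofReal_pow] using hY0 s

/-- As `log ‖Y‖²` is real, the real part of `2 ∂̄` is its derivative in direction `1`, that is, `2
Re (∂ log ‖Y‖²)`. This links the period means of `log ‖Y‖²` to those of the previous quotient. -/
theorem dbar_log_inner (hY : Differentiable ℂ Y) (hY0 : ∀ s, Y s ≠ 0) (s : ℂ) :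
    let F := fun s => ((Real.log (⟪Y s, Y s⟫_ℂ).re : ℝ) : ℂ)
    (fderiv ℝ F s 1 + Complex.I * fderiv ℝ F s Complex.I).re =
      2 * (⟪Y s, deriv Y s⟫_ℂ / ⟪Y s, Y s⟫_ℂ).re := by
  intro F
  have hdF : DifferentiableAt ℝ F s := (Complex.ofRealCLM.contDiff.comp
    (contDiff_log_inner hY hY0)).differentiable one_ne_zero s
  have hn : ⟪Y s, Y s⟫_ℂ = ((‖Y s‖ ^ 2 : ℝ) : ℂ) := by
    rw [inner_self_eq_norm_sq_to_K]; norm_cast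
  have hl : ∀ c : ℂ, fderiv ℝ F s c =
      (((⟪Y s, c • deriv Y s⟫_ℂ + ⟪c • deriv Y s, Y s⟫_ℂ).re / ‖Y s‖ ^ 2 : ℝ) : ℂ) := by
    intro c
    have h1 := hasDerivAt_line hY s c
    have h3 := (Complex.reCLM.hasFDerivAt.comp_hasDerivAt (0 : ℝ) (h1.inner ℂ h1)).log
      (by simpa [hn, ← Complex.ofReal_pow] using hY0 s)
    have h4 : HasLineDerivAt ℝ F _ s c := h3.ofReal_comp
    rw [← hdF.lineDeriv_eq_fderiv, h4.lineDeriv]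
    simp only [zero_smul, add_zero, Function.comp_apply, Complex.reCLM_apply, hn, Complex.ofReal_re]
  rw [hl, hl, hn, Complex.div_ofReal_re, Complex.add_re, Complex.ofReal_re,
    Complex.re_mul_ofReal, Complex.I_re, zero_mul, add_zero, one_smul, Complex.add_re,
    ← inner_conj_symm (deriv Y s), Complex.conj_re]
  ring

end strip

/-! ### Jensen-type estimates and the reduction to quadratic exponents. -/

section growth

variable {n : ℕ}

/-- The circle means of `log ‖Y ∘ exp‖²` grow at most like `r² = e^{2b}` if the curve `Y ∘ exp` has
Fubini–Study energy density at most `K r²`. -/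
theorem exists_integral_log_inner_le {Y : ℂ → EuclideanSpace ℂ (Fin (n + 1))}
    (hY : Differentiable ℂ Y) (hY0 : ∀ s, Y s ≠ 0)
    (hper : ∀ s, Y (s + 2 * Real.pi * Complex.I) = Y s) {K : ℝ} (hK0 : 0 ≤ K)
    (hK : ∀ s, CProj.fsHom (Y s) (deriv Y s) (deriv Y s) ≤ K * Real.exp (2 * s.re)) :
    ∃ C : ℝ, ∀ b : ℝ, 0 ≤ b →
      ∫ y in (0 : ℝ)..2 * Real.pi, Real.log (⟪Y (b + y * Complex.I), Y (b + y * Complex.I)⟫_ℂ).re ≤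
        C * Real.exp (2 * b) := by
  have hpi := Real.pi_pos
  set Q : ℂ → ℂ := fun s => ⟪Y s, deriv Y s⟫_ℂ / ⟪Y s, Y s⟫_ℂ with hQ
  set Φ : ℂ → ℝ := fun s => Real.log (⟪Y s, Y s⟫_ℂ).re with hΦ
  have hdper : ∀ s, deriv Y (s + 2 * Real.pi * Complex.I) = deriv Y s := by
    intro s
    rw [← deriv_comp_add_const]
    simp only [hper]
  have hQc : ContDiff ℝ 1 Q := contDiff_inner_deriv_div hY hY0
  have hQcont := hQc.continuous
  have hΦc : ContDiff ℝ 1 fun s => (Φ s : ℂ) :=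
    Complex.ofRealCLM.contDiff.comp (contDiff_log_inner hY hY0)
  set m : ℝ → ℝ := fun x => ∫ y in (0 : ℝ)..2 * Real.pi, (Q (x + y * Complex.I)).re with hm
  have hmc : Continuous m := by
    refine intervalIntegral.continuous_parametric_intervalIntegral_of_continuous' ?_ _ _
    unfold Function.uncurry
    fun_prop
  have hexp : ∀ b : ℝ, ∫ x in (0 : ℝ)..b, Real.exp (2 * x) = (Real.exp (2 * b) - 1) / 2 := by
    intro b
    rw [intervalIntegral.integral_comp_mul_left (fun x => Real.exp x) two_ne_zero]
    simp
    ring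
  have hfs := continuous_fsHom_deriv hY hY0
  -- First integration: the increment of `m` is the integral of `2π` times the density over the
  -- strip, at most `∫ 4π² K e^{2x}`.
  have h1 : ∀ b : ℝ, 0 ≤ b → m b ≤ m 0 + 2 * Real.pi ^ 2 * K * Real.exp (2 * b) := by
    intro b hb
    have h := integral_period_re_sub hQc (fun s => by simp only [hQ, hper, hdper]) 0 b
    simp only [hQ, dbar_inner_deriv_div hY hY0] at h
    have h2 : ∫ x in (0 : ℝ)..b, ∫ y in (0 : ℝ)..2 * Real.pi,
        2 * Real.pi * CProj.fsHom (Y (x + y * Complex.I)) (deriv Y (x + y * Complex.I))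
          (deriv Y (x + y * Complex.I)) ≤
        ∫ x in (0 : ℝ)..b, 4 * Real.pi ^ 2 * K * Real.exp (2 * x) := by
      refine intervalIntegral.integral_mono_on hb (Continuous.intervalIntegrable (by
        refine intervalIntegral.continuous_parametric_intervalIntegral_of_continuous' ?_ _ _
        unfold Function.uncurry
        exact continuous_const.mul (hfs.comp (by fun_prop))) _ _)
        (Continuous.intervalIntegrable (by fun_prop) _ _) fun x _ => ?_
      calc ∫ y in (0 : ℝ)..2 * Real.pi,
            2 * Real.pi * CProj.fsHom (Y (x + y * Complex.I)) (deriv Y (x + y * Complex.I))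
              (deriv Y (x + y * Complex.I)) ≤
          ∫ y in (0 : ℝ)..2 * Real.pi, 2 * Real.pi * (K * Real.exp (2 * x)) := by
            refine intervalIntegral.integral_mono_on (by positivity)
              (Continuous.intervalIntegrable
                (continuous_const.mul (hfs.comp (by fun_prop))) _ _)
              intervalIntegrable_const fun y _ => ?_
            gcongr
            simpa using hK (x + y * Complex.I)
        _ = _ := by rw [intervalIntegral.integral_const, smul_eq_mul]; ring
    rw [intervalIntegral.integral_const_mul, hexp, ← h] at h2
    have h3 : 0 ≤ Real.pi ^ 2 * K := by positivity
    simp only [hm, hQ]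
    linarith
  -- Second integration: the period integral of `Φ` grows at rate `2 * m`.
  have h2 : ∀ b : ℝ, 0 ≤ b → (∫ y in (0 : ℝ)..2 * Real.pi, Φ (b + y * Complex.I)) -
      (∫ y in (0 : ℝ)..2 * Real.pi, Φ ((0 : ℝ) + y * Complex.I)) ≤
      2 * |m 0| * b + 2 * Real.pi ^ 2 * K * (Real.exp (2 * b) - 1) := by
    intro b hb
    have h := integral_period_re_sub hΦc (fun s => by simp only [hΦ, hper]) 0 b
    simp only [hΦ, dbar_log_inner hY hY0, Complex.ofReal_re] at h
    simp only [hΦ]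
    rw [h]
    simp only [intervalIntegral.integral_const_mul]
    have h3 : ∫ x in (0 : ℝ)..b, m x ≤
        ∫ x in (0 : ℝ)..b, (|m 0| + 2 * Real.pi ^ 2 * K * Real.exp (2 * x)) := by
      refine intervalIntegral.integral_mono_on hb (hmc.intervalIntegrable _ _)
        (Continuous.intervalIntegrable (by fun_prop) _ _) fun x hx => ?_
      exact (h1 x hx.1).trans (by gcongr; exact le_abs_self _)
    rw [intervalIntegral.integral_add intervalIntegrable_const
      (Continuous.intervalIntegrable (by fun_prop) _ _), intervalIntegral.integral_const,
      intervalIntegral.integral_const_mul, hexp, smul_eq_mul] at h3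
    simp only [hm, hQ] at h3 ⊢
    linarith
  refine ⟨|∫ y in (0 : ℝ)..2 * Real.pi, Φ ((0 : ℝ) + y * Complex.I)| + 2 * |m 0| +
    2 * Real.pi ^ 2 * K, fun b hb => ?_⟩
  have h3 := h2 b hb
  -- For `b ≥ 0` both `1` and `b` are at most `e^{2b}`, so constant and linear terms are absorbed.
  have h4 := Real.add_one_le_exp (2 * b)
  have h5 := le_abs_self (∫ y in (0 : ℝ)..2 * Real.pi, Φ ((0 : ℝ) + y * Complex.I))
  set N := ∫ y in (0 : ℝ)..2 * Real.pi, Φ ((0 : ℝ) + y * Complex.I)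
  have h6 : |N| * 1 ≤ |N| * Real.exp (2 * b) := by gcongr; linarith
  have h7 : |m 0| * b ≤ |m 0| * Real.exp (2 * b) := by gcongr; linarith
  have h8 : 0 ≤ Real.pi ^ 2 * K := by positivity
  have h9 : ∫ y in (0 : ℝ)..2 * Real.pi, Φ (b + y * Complex.I) ≤ _ := sub_le_iff_le_add.1 h3
  refine h9.trans ?_
  linarith

/-- The circle means of `log ‖V‖` grow at most quadratically for an entire curve `V` in
`ℂⁿ⁺¹ ∖ {0}` whose projection to `ℂPⁿ` has bounded derivative. -/
theorem exists_circleAverage_log_norm_le {V : ℂ → EuclideanSpace ℂ (Fin (n + 1))}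
    (hV : Differentiable ℂ V) (hV0 : ∀ z, V z ≠ 0) {K : ℝ}
    (hK : ∀ z, CProj.fsHom (V z) (deriv V z) (deriv V z) ≤ K) :
    ∃ C : ℝ, ∀ r : ℝ, 1 ≤ r → Real.circleAverage (fun z => Real.log ‖V z‖) 0 r ≤ C * r ^ 2 := by
  have hK0 : 0 ≤ K := (CProj.fsHom_self_nonneg _ _).trans (hK 0)
  have hd : ∀ s, deriv (fun s => V (Complex.exp s)) s = Complex.exp s • deriv V (Complex.exp s) :=
    fun s => ((hV _).hasDerivAt.scomp s (Complex.hasDerivAt_exp s)).deriv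
  -- With `z = e^s` the circle of radius `r` becomes a vertical period over `Re s = log r`, and the
  -- chain rule multiplies the density by `|e^s|² = e^{2 Re s}`.
  obtain ⟨C, hC⟩ := exists_integral_log_inner_le (Y := fun s => V (Complex.exp s))
    (hV.comp Complex.differentiable_exp) (fun s => hV0 _)
    (fun s => by rw [Complex.exp_periodic]) hK0 (fun s => by
      have h := hK (Complex.exp s)
      rw [hd, CProj.fsHom_self, norm_smul, inner_smul_right, norm_mul, Complex.norm_exp]
      rw [CProj.fsHom_self] at h
      have e : Real.exp (2 * s.re) = Real.exp s.re ^ 2 := by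
        rw [← Real.exp_nat_mul]; simp
      rw [e]
      refine le_trans (le_of_eq ?_) (mul_le_mul_of_nonneg_right h (by positivity))
      ring)
  -- The factor `(2π)⁻¹` normalises the circle average; the `2` comes from `log ‖V‖² = 2 log ‖V‖`.
  refine ⟨C * (2 * Real.pi)⁻¹ / 2, fun r hr => ?_⟩
  have hr0 : 0 < r := by linarith
  have h := hC (Real.log r) (Real.log_nonneg hr)
  have e : Real.exp (2 * Real.log r) = r ^ 2 := by
    rw [two_mul, Real.exp_add, Real.exp_log hr0, sq]
  have e2 : ∀ y : ℝ, Real.log (⟪V (Complex.exp (Real.log r + y * Complex.I)),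
      V (Complex.exp (Real.log r + y * Complex.I))⟫_ℂ).re = 2 * Real.log ‖V (circleMap 0 r y)‖ := by
    intro y
    rw [Complex.exp_add, ← Complex.ofReal_exp, Real.exp_log hr0, inner_self_eq_norm_sq_to_K]
    simp [circleMap, ← Complex.ofReal_pow]
  simp only [e2, intervalIntegral.integral_const_mul] at h
  rw [e] at h
  rw [Real.circleAverage_def, smul_eq_mul]
  have := mul_le_mul_of_nonneg_left h (inv_nonneg.2 (by positivity : 0 ≤ 2 * Real.pi))
  linarith

/-- If `[e^{g₀} : … : e^{gₙ}]`, with entire `gᵢ` and `Re g₀ = 0`, has bounded derivative, then the `gᵢ`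
are polynomials of degree at most two. -/
theorem exists_eq_quadratic_of_fsHom_exp_le {g : Fin (n + 1) → ℂ → ℂ}
    (hg : ∀ i, Differentiable ℂ (g i)) (hg0 : ∀ z, (g 0 z).re = 0)
    {V : ℂ → EuclideanSpace ℂ (Fin (n + 1))} (hVg : ∀ z i, V z i = Complex.exp (g i z)) {K : ℝ}
    (hK : ∀ z, CProj.fsHom (V z) (deriv V z) (deriv V z) ≤ K) (i : Fin (n + 1)) :
    ∃ a b c : ℂ, ∀ z, g i z = a * z ^ 2 + b * z + c := by
  have hV : Differentiable ℂ V := by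
    rw [differentiable_piLp]
    intro j
    simp only [hVg]
    exact (hg j).cexp
  have hV1 : ∀ z j, Real.exp (g j z).re ≤ ‖V z‖ := fun z j => by
    rw [← Complex.norm_exp, ← hVg]; exact PiLp.norm_apply_le _ _
  have hpos : ∀ z, 0 < ‖V z‖ := fun z => (Real.exp_pos _).trans_le (hV1 z 0)
  have hV0 : ∀ z, V z ≠ 0 := fun z => norm_pos_iff.1 (hpos z)
  obtain ⟨C, hC⟩ := exists_circleAverage_log_norm_le hV hV0 hK
  refine exists_eq_quadratic_of_re_le (hg i) fun r hr w hw =>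
    re_le_of_circleAverage_posPart_le (hg i) (K := C) (fun r hr => le_trans ?_ (hC r hr)) hr hw
  refine Real.circleAverage_mono ?_ ?_ fun z _ => ?_
  · have := (hg i).continuous
    exact (by fun_prop : Continuous fun z => max (g i z).re 0).continuousOn.circleIntegrable'
  · exact (hV.continuous.norm.log fun z => (hpos z).ne').continuousOn.circleIntegrable'
  -- The normalisation `Re (g 0) = 0` is what makes `log ‖V‖` nonnegative.
  · refine max_le ?_ ?_
    · rw [Real.le_log_iff_exp_le (hpos z)]; exact hV1 z i
    · rw [Real.le_log_iff_exp_le (hpos z)]; simpa [hg0] using hV1 z 0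

end growth

/-! ## Vanishing of the mean energy -/

theorem lintegral_closedBall_eq_smul {f : ℂ → ℝ≥0∞} (hf : Measurable f) {R : ℝ} (hR : 0 < R) :
    ∫⁻ z in Metric.closedBall (0 : ℂ) 1, f (R • z) =
      (∫⁻ z in Metric.closedBall (0 : ℂ) R, f z) / ENNReal.ofReal (R ^ 2) := by
  have hpre : (fun z : ℂ => R • z) ⁻¹' Metric.closedBall 0 R = Metric.closedBall 0 1 := by
    ext z
    simp only [Set.mem_preimage, mem_closedBall_zero_iff, norm_smul, Real.norm_eq_abs,
      abs_of_pos hR]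
    exact mul_le_iff_le_one_right hR
  rw [← hpre, ← setLIntegral_map Metric.isClosed_closedBall.measurableSet hf
    (measurable_const_smul R), Measure.map_addHaar_smul volume hR.ne', Measure.restrict_smul,
    lintegral_smul_measure, Complex.finrank_real_complex, abs_of_pos (by positivity),
    ENNReal.ofReal_inv_of_pos (by positivity), smul_eq_mul, mul_comm, ENNReal.div_eq_inv_mul,
    mul_comm]

/-- A bounded energy density which tends to zero along almost every ray has mean zero. -/
theorem limsup_mean_eq_zero {D : ℂ → ℝ} (hD : Continuous D) {M : ℝ} (hM : ∀ z, D z ≤ M)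
    (h0 : ∀ᵐ w : ℂ, Tendsto (fun R : ℝ => D (R • w)) atTop (nhds 0)) :
    limsup (fun R : ℝ => (∫⁻ z in Metric.closedBall (0 : ℂ) R, ENNReal.ofReal (D z)) /
      ENNReal.ofReal (Real.pi * R ^ 2)) atTop = 0 := by
  refine Tendsto.limsup_eq ?_
  have h1 : Tendsto (fun R : ℝ => ∫⁻ z in Metric.closedBall (0 : ℂ) 1, ENNReal.ofReal (D (R • z)))
      atTop (nhds 0) := by
    -- After rescaling, the constant `M` is an integrable majorant on the unit disc.
    have h := tendsto_lintegral_filter_of_dominated_convergence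
      (μ := volume.restrict (Metric.closedBall (0 : ℂ) 1)) (l := atTop)
      (F := fun (R : ℝ) z => ENNReal.ofReal (D (R • z))) (f := fun _ => 0)
      (fun _ => ENNReal.ofReal M)
      (Eventually.of_forall fun R => (hD.comp (continuous_const_smul R)).measurable.ennreal_ofReal)
      (Eventually.of_forall fun R => Eventually.of_forall fun z => ENNReal.ofReal_le_ofReal (hM _))
      (by
        rw [setLIntegral_const]
        exact ENNReal.mul_ne_top ENNReal.ofReal_ne_top measure_closedBall_lt_top.ne)
      (by
        filter_upwards [ae_restrict_of_ae h0] with w hw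
        simpa using ENNReal.tendsto_ofReal hw)
    simpa using h
  have h2 : Tendsto (fun R : ℝ => (∫⁻ z in Metric.closedBall (0 : ℂ) 1,
      ENNReal.ofReal (D (R • z))) / ENNReal.ofReal Real.pi) atTop (nhds 0) := by
    have := ENNReal.Tendsto.div_const h1
      (Or.inr (by simpa using Real.pi_pos : ENNReal.ofReal Real.pi ≠ 0))
    simpa using this
  refine h2.congr' ?_
  filter_upwards [eventually_gt_atTop 0] with R hR
  rw [lintegral_closedBall_eq_smul hD.measurable.ennreal_ofReal hR,
    ENNReal.ofReal_mul Real.pi_pos.le, ENNReal.div_eq_inv_mul, ENNReal.div_eq_inv_mul,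
    ENNReal.div_eq_inv_mul, ENNReal.mul_inv (Or.inr ENNReal.ofReal_ne_top)
    (Or.inl ENNReal.ofReal_ne_top), mul_assoc]

/-- The exceptional set is the kernel of a nonzero real linear functional, a proper real subspace
and hence null. -/
theorem ae_re_mul_ne_zero {b : ℂ} (hb : b ≠ 0) : ∀ᵐ w : ℂ, (b * w).re ≠ 0 := by
  let S : Submodule ℝ ℂ := LinearMap.ker (Complex.reLm ∘ₗ LinearMap.mulLeft ℝ b)
  have hS : S ≠ ⊤ := by
    intro h
    have : b⁻¹ ∈ S := h ▸ Submodule.mem_top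
    simp [S, hb] at this
  have h := Measure.addHaar_submodule volume S hS
  rw [ae_iff]
  convert h using 2
  ext w
  simp [S]

/-- With `a = b²` and `b * w = x + iy`, the real part is `x² - y² = (x - y)(x + y)`, so it vanishes
on two lines only. The factors are the real parts of `(1 ± I) * b * w`. -/
theorem ae_re_mul_sq_ne_zero {a : ℂ} (ha : a ≠ 0) : ∀ᵐ w : ℂ, (a * w ^ 2).re ≠ 0 := by
  obtain ⟨b, rfl⟩ := IsAlgClosed.exists_pow_nat_eq a two_pos
  have hb : b ≠ 0 := fun h => ha (by simp [h])
  have h1 : (1 + Complex.I) * b ≠ 0 :=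
    mul_ne_zero (fun h => by simpa using congrArg Complex.re h) hb
  have h2 : (1 - Complex.I) * b ≠ 0 :=
    mul_ne_zero (fun h => by simpa using congrArg Complex.re h) hb
  filter_upwards [ae_re_mul_ne_zero h1, ae_re_mul_ne_zero h2] with w hw1 hw2
  have : (b ^ 2 * w ^ 2).re = ((1 + Complex.I) * b * w).re * ((1 - Complex.I) * b * w).re := by
    rw [← mul_pow, mul_assoc, mul_assoc, sq]
    simp
    ring
  rw [this]
  exact mul_ne_zero hw1 hw2

/-- The real part of a nonconstant polynomial of degree at most two grows at least linearly along
almost every ray. -/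
theorem ae_exists_le_abs_re_quadratic {a b : ℂ} (c : ℂ) (hab : a ≠ 0 ∨ b ≠ 0) :
    ∀ᵐ w : ℂ, ∃ δ C : ℝ, 0 < δ ∧ ∀ R : ℝ, 0 ≤ R →
      δ * R - C ≤ |(a * (R • w) ^ 2 + b * (R • w) + c).re| := by
  have hre : ∀ (w : ℂ) (R : ℝ), (a * (R • w) ^ 2 + b * (R • w) + c).re =
      R ^ 2 * (a * w ^ 2).re + R * (b * w).re + c.re := by
    intro w R
    rw [← Complex.re_ofReal_mul, ← Complex.re_ofReal_mul, ← Complex.add_re, ← Complex.add_re,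
      Complex.real_smul]
    congr 1
    push_cast
    ring
  by_cases ha : a = 0
  · filter_upwards [ae_re_mul_ne_zero (hab.resolve_left (not_not.2 ha))] with w hw
    refine ⟨|(b * w).re|, |c.re|, abs_pos.2 hw, fun R hR => ?_⟩
    rw [hre, ha, zero_mul, Complex.zero_re, mul_zero, zero_add, ← abs_of_nonneg hR, mul_comm,
      ← abs_mul, abs_of_nonneg hR]
    have := abs_sub_abs_le_abs_sub (R * (b * w).re) (-c.re)
    rwa [abs_neg, sub_neg_eq_add] at this
  · filter_upwards [ae_re_mul_sq_ne_zero ha] with w hw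
    set α := (a * w ^ 2).re
    set β := (b * w).re
    have hα : 0 < |α| := abs_pos.2 hw
    -- The constant comes from completing the square in `|α| R² - (|β| + 1) R`, which leaves slope
    -- `1`.
    refine ⟨1, |c.re| + (|β| + 1) ^ 2 / (4 * |α|), one_pos, fun R hR => ?_⟩
    have h1 : R ^ 2 * |α| - R * |β| - |c.re| ≤ |R ^ 2 * α + R * β + c.re| := by
      have h2 := abs_sub_abs_le_abs_sub (R ^ 2 * α) (-(R * β + c.re))
      have h3 := abs_add_le (R * β) c.re
      rw [abs_neg, sub_neg_eq_add, ← add_assoc, abs_mul, abs_of_nonneg (sq_nonneg R)] at h2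
      rw [abs_mul, abs_of_nonneg hR] at h3
      linarith
    have h4 : R ^ 2 * |α| - R * (|β| + 1) + (|β| + 1) ^ 2 / (4 * |α|) =
        |α| * (R - (|β| + 1) / (2 * |α|)) ^ 2 := by
      field_simp
      ring
    have h5 : 0 ≤ |α| * (R - (|β| + 1) / (2 * |α|)) ^ 2 := by positivity
    rw [hre]
    linarith

/-- On almost every ray the exponent decreases at least linearly while the derivative squared grows
at most like `R²`. For a constant polynomial the second factor is identically zero. -/
theorem ae_tendsto_exp_neg_abs_re_quadratic (a b c : ℂ) :
    ∀ᵐ w : ℂ, Tendsto (fun R : ℝ =>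
      Real.exp (-2 * |(a * (R • w) ^ 2 + b * (R • w) + c).re|) * ‖2 * a * (R • w) + b‖ ^ 2)
      atTop (nhds 0) := by
  by_cases hab : a ≠ 0 ∨ b ≠ 0
  · filter_upwards [ae_exists_le_abs_re_quadratic c hab] with w ⟨δ, C, hδ, h⟩
    have h1 : Tendsto (fun R : ℝ => (Real.exp (2 * C) * (‖2 * a * w‖ + ‖b‖) ^ 2) *
        (R ^ (2 : ℝ) * Real.exp (-(2 * δ) * R))) atTop (nhds 0) := by
      simpa using (tendsto_rpow_mul_exp_neg_mul_atTop_nhds_zero 2 (2 * δ) (by positivity)).const_mul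
        (Real.exp (2 * C) * (‖2 * a * w‖ + ‖b‖) ^ 2)
    refine tendsto_of_tendsto_of_tendsto_of_le_of_le' tendsto_const_nhds h1
      (Eventually.of_forall fun R => by positivity) ?_
    filter_upwards [eventually_ge_atTop 1] with R hR
    have hR0 : 0 ≤ R := by linarith
    have h2 : ‖2 * a * (R • w) + b‖ ≤ (‖2 * a * w‖ + ‖b‖) * R := by
      refine (norm_add_le _ _).trans ?_
      rw [mul_smul_comm, norm_smul, Real.norm_of_nonneg hR0]
      nlinarith [norm_nonneg b]
    calc _ ≤ Real.exp (2 * C + -(2 * δ) * R) * ((‖2 * a * w‖ + ‖b‖) * R) ^ 2 := by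
          gcongr
          linarith [h R hR0]
      _ = _ := by
          rw [Real.exp_add, Real.rpow_two]
          ring
  · push Not at hab
    simp [hab.1, hab.2]

/-! ### Energy density of exponential curves. -/

section energy

variable {n : ℕ}

theorem deriv_apply_of_apply_eq_exp {g : Fin (n + 1) → ℂ → ℂ} (hg : ∀ i, Differentiable ℂ (g i))
    {V : ℂ → EuclideanSpace ℂ (Fin (n + 1))} (hVg : ∀ z i, V z i = Complex.exp (g i z)) (z : ℂ)
    (i : Fin (n + 1)) : deriv V z i = Complex.exp (g i z) * deriv (g i) z := by
  have hV : Differentiable ℂ V := by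
    rw [differentiable_piLp]
    intro j
    simp only [hVg]
    exact (hg j).cexp
  have h1 : HasDerivAt (fun z => V z i) (deriv V z i) z :=
    (EuclideanSpace.proj (𝕜 := ℂ) i).hasFDerivAt.comp_hasDerivAt z (hV z).hasDerivAt
  have h2 : HasDerivAt (fun z => V z i) (Complex.exp (g i z) * deriv (g i) z) z := by
    simp only [hVg]
    exact (hg i z).hasDerivAt.cexp
  exact h1.unique h2

/-- The energy density of `[e^{g₀} : … : e^{gₙ}]` is concentrated where two of the coordinates have
nearly the same absolute value. -/
theorem fsHom_exp_le {g : Fin (n + 1) → ℂ → ℂ} (hg : ∀ i, Differentiable ℂ (g i))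
    {V : ℂ → EuclideanSpace ℂ (Fin (n + 1))} (hVg : ∀ z i, V z i = Complex.exp (g i z)) (z : ℂ) :
    CProj.fsHom (V z) (deriv V z) (deriv V z) ≤ Real.pi⁻¹ * ∑ k, ∑ i,
      Real.exp (-2 * |(g i z - g k z).re|) * ‖deriv (g i) z - deriv (g k) z‖ ^ 2 := by
  -- The coordinate `k` of largest modulus at `z` bounds `‖V z‖` from below, and `a = deriv (g k) z`
  -- turns component `i` into `V z i * (g i' - g k')`. Since `k` varies with `z`, the bound sums
  -- over all `k`.
  obtain ⟨k, hk⟩ := Finite.exists_max fun i => (g i z).re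
  have hnorm : ∀ i, ‖V z i‖ = Real.exp (g i z).re := fun i => by rw [hVg, Complex.norm_exp]
  have hVk : Real.exp (g k z).re ≤ ‖V z‖ := by rw [← hnorm]; exact PiLp.norm_apply_le _ _
  have hV0 : V z ≠ 0 := norm_pos_iff.1 ((Real.exp_pos _).trans_le hVk)
  refine (CProj.fsHom_self_le _ _ hV0 (deriv (g k) z)).trans ?_
  refine mul_le_mul_of_nonneg_left ?_ (inv_nonneg.2 Real.pi_pos.le)
  refine le_trans ?_ (Finset.single_le_sum (f := fun k => ∑ i,
    Real.exp (-2 * |(g i z - g k z).re|) * ‖deriv (g i) z - deriv (g k) z‖ ^ 2)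
    (fun k _ => Finset.sum_nonneg fun i _ => by positivity) (Finset.mem_univ k))
  rw [EuclideanSpace.norm_sq_eq, Finset.sum_div]
  refine Finset.sum_le_sum fun i _ => ?_
  have e : (deriv V z - deriv (g k) z • V z) i =
      V z i * (deriv (g i) z - deriv (g k) z) := by
    simp only [PiLp.sub_apply, PiLp.smul_apply, smul_eq_mul, deriv_apply_of_apply_eq_exp hg hVg,
      hVg]
    ring
  rw [e, norm_mul, mul_pow, mul_div_right_comm, hnorm]
  refine mul_le_mul_of_nonneg_right ?_ (by positivity)
  rw [Complex.sub_re, abs_of_nonpos (sub_nonpos.2 (hk i)), ← div_pow]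
  have e2 : Real.exp (-2 * -((g i z).re - (g k z).re)) =
      (Real.exp (g i z).re / Real.exp (g k z).re) ^ 2 := by
    rw [← Real.exp_sub, ← Real.exp_nat_mul]
    congr 1
    push_cast
    ring
  rw [e2]
  gcongr

/-- If `[e^{g₀} : … : e^{gₙ}]`, with `Re g₀ = 0`, has bounded derivative, then its energy density tends to zero along
almost every ray. -/
theorem ae_tendsto_fsHom_exp {g : Fin (n + 1) → ℂ → ℂ} (hg : ∀ i, Differentiable ℂ (g i))
    (hg0 : ∀ z, (g 0 z).re = 0) {V : ℂ → EuclideanSpace ℂ (Fin (n + 1))}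
    (hVg : ∀ z i, V z i = Complex.exp (g i z)) {K : ℝ}
    (hK : ∀ z, CProj.fsHom (V z) (deriv V z) (deriv V z) ≤ K) :
    ∀ᵐ w : ℂ, Tendsto (fun R : ℝ => CProj.fsHom (V (R • w)) (deriv V (R • w)) (deriv V (R • w)))
      atTop (nhds 0) := by
  choose a b c habc using exists_eq_quadratic_of_fsHom_exp_le hg hg0 hVg hK
  have hd : ∀ i z, deriv (g i) z = 2 * a i * z + b i := by
    intro i z
    rw [funext (habc i)]
    have h := (((hasDerivAt_pow 2 z).const_mul (a i)).add
      ((hasDerivAt_id z).const_mul (b i))).add_const (c i)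
    refine h.deriv.trans ?_
    simp
    ring
  have hae : ∀ᵐ w : ℂ, ∀ k i, Tendsto (fun R : ℝ =>
      Real.exp (-2 * |(g i (R • w) - g k (R • w)).re|) *
        ‖deriv (g i) (R • w) - deriv (g k) (R • w)‖ ^ 2) atTop (nhds 0) := by
    rw [ae_all_iff]; intro k
    rw [ae_all_iff]; intro i
    filter_upwards [ae_tendsto_exp_neg_abs_re_quadratic (a i - a k) (b i - b k) (c i - c k)]
      with w hw
    refine hw.congr fun R => ?_
    rw [hd, hd, habc, habc]
    congr 5 <;> ring
  filter_upwards [hae] with w hw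
  refine squeeze_zero (fun R => CProj.fsHom_self_nonneg _ _) (fun R => fsHom_exp_le hg hVg _) ?_
  simpa using (tendsto_finsetSum Finset.univ fun k _ =>
    tendsto_finsetSum Finset.univ fun i _ => hw k i).const_mul Real.pi⁻¹

end energy

/-! ## Holomorphic curves in `ℂPⁿ` in homogeneous coordinates -/

/-- A nowhere vanishing entire function has an entire logarithm. -/
theorem exists_differentiable_eq_exp {W : ℂ → ℂ} (hW : Differentiable ℂ W) (hW0 : ∀ z, W z ≠ 0) :
    ∃ g : ℂ → ℂ, Differentiable ℂ g ∧ ∀ z, W z = Complex.exp (g z) := by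
  -- `g` is the primitive of `W' / W` with `g 0 = log (W 0)`; then `W * e^{-g}` has derivative zero
  -- and value one at the origin.
  obtain ⟨g, hg0, hg⟩ := ((differentiable_deriv_of_entire hW).div hW hW0).isExactOn_univ.with_val_at 0 (Complex.log (W 0))
  have hgd : ∀ z, HasDerivAt g (deriv W z / W z) z := fun z => hg z (Set.mem_univ z)
  refine ⟨g, fun z => (hgd z).differentiableAt, fun z => ?_⟩
  have hd : ∀ z, HasDerivAt (fun z => W z * Complex.exp (-g z)) 0 z := fun z => by
    have := (hW z).hasDerivAt.mul (hgd z).neg.cexp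
    refine this.congr_deriv ?_
    have := hW0 z
    field_simp
    ring
  have hc := is_const_of_deriv_eq_zero (fun z => (hd z).differentiableAt)
    (fun z => (hd z).deriv) z 0
  simp only [hg0, Complex.exp_neg, Complex.exp_log (hW0 0), mul_inv_cancel₀ (hW0 0)] at hc
  have := Complex.exp_ne_zero (g z)
  field_simp at hc
  exact hc

section restrict

variable {n : ℕ} {X : Type*} [TopologicalSpace X] [ChartedSpace (EuclideanSpace ℂ (Fin n)) X]

theorem IsHolomorphicCurve.val {U : TopologicalSpace.Opens X} {f : ℂ → U}
    (hf : IsHolomorphicCurve n f) : IsHolomorphicCurve n fun z => (f z : X) :=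
  fun z => (mdifferentiableAt_opens_val U (f z)).comp z (hf z)

variable [IsManifold 𝓘(ℂ, EuclideanSpace ℂ (Fin n)) ω X]

theorem HermitianMetric.normDeriv_restrict (g : HermitianMetric n X) {U : TopologicalSpace.Opens X}
    {f : ℂ → U} (hf : IsHolomorphicCurve n f) (z : ℂ) :
    (g.restrict U).normDeriv f z = g.normDeriv (fun z => (f z : X)) z := by
  have hc := mfderiv_comp (I := 𝓘(ℂ, ℂ)) (I' := 𝓘(ℂ, EuclideanSpace ℂ (Fin n)))
    (I'' := 𝓘(ℂ, EuclideanSpace ℂ (Fin n))) (f := f) (g := (Subtype.val : U → X)) z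
    (mdifferentiableAt_opens_val U (f z)) (hf z)
  have hc1 := DFunLike.congr_fun hc (1 : ℂ)
  have key : ∀ a b : TangentSpace 𝓘(ℂ, EuclideanSpace ℂ (Fin n)) (f z : X), a = b →
      √(g.inner (f z : X) a a) = √(g.inner (f z : X) b b) := by
    rintro a _ rfl; rfl
  exact key _ _ hc1.symm

end restrict

/-! ### Lifts of curves to homogeneous coordinates, and the conclusion. -/

namespace CProj

variable {n : ℕ}

theorem mdifferentiableAt_chart {i : Fin (n + 1)} {p : CProj n} (hp : p.rep i ≠ 0) :
    MDifferentiableAt 𝓘(ℂ, EuclideanSpace ℂ (Fin n)) 𝓘(ℂ, EuclideanSpace ℂ (Fin n)) (chart i) p := by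
  have h1 : IsManifold 𝓘(ℂ, EuclideanSpace ℂ (Fin n)) 1 (CProj n) :=
    IsManifold.of_le (n := ω) le_top
  exact mdifferentiableAt_atlas (chart_mem_atlas i) hp

theorem differentiableAt_coord {F : ℂ → CProj n} (hF : IsHolomorphicCurve n F) {i : Fin (n + 1)}
    {z : ℂ} (hi : (F z).rep i ≠ 0) : DifferentiableAt ℂ (fun z => coord i (F z)) z :=
  mdifferentiableAt_iff_differentiableAt.1 ((mdifferentiableAt_chart hi).comp z (hF z))

/-- The index `k` is the chart that the definition of `fubiniStudy` selects at the point; the chain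
rule moves the derivative into that chart. -/
theorem normDeriv_fubiniStudy_sq {F : ℂ → CProj n} (hF : IsHolomorphicCurve n F) (z : ℂ) :
    ∃ k, (F z).rep k ≠ 0 ∧ (fubiniStudy n).normDeriv F z ^ 2 =
      fsCoord (coord k (F z)) (deriv (fun z => coord k (F z)) z)
        (deriv (fun z => coord k (F z)) z) := by
  refine ⟨(F z).exists_rep_apply_ne_zero.choose, (F z).exists_rep_apply_ne_zero.choose_spec, ?_⟩
  set k := (F z).exists_rep_apply_ne_zero.choose with hk
  have hkz : (F z).rep k ≠ 0 := (F z).exists_rep_apply_ne_zero.choose_spec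
  have hc := mfderiv_comp (I := 𝓘(ℂ, ℂ)) (I' := 𝓘(ℂ, EuclideanSpace ℂ (Fin n)))
    (I'' := 𝓘(ℂ, EuclideanSpace ℂ (Fin n))) (f := F) (g := chart k) z
    (mdifferentiableAt_chart hkz) (hF z)
  have hc1 := DFunLike.congr_fun hc (1 : ℂ)
  have hc2 : mfderiv 𝓘(ℂ, ℂ) 𝓘(ℂ, EuclideanSpace ℂ (Fin n)) (chart k ∘ F) z (1 : ℂ) =
      deriv (fun z => coord k (F z)) z := by
    rw [mfderiv_eq_fderiv]
    exact fderiv_apply_one_eq_deriv (𝕜 := ℂ) (f := fun z => coord k (F z)) (x := z)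
  have hnn : 0 ≤ (fubiniStudy n).inner (F z)
      (mfderiv 𝓘(ℂ, ℂ) 𝓘(ℂ, EuclideanSpace ℂ (Fin n)) F z (1 : ℂ))
      (mfderiv 𝓘(ℂ, ℂ) 𝓘(ℂ, EuclideanSpace ℂ (Fin n)) F z (1 : ℂ)) := by
    by_cases h : mfderiv 𝓘(ℂ, ℂ) 𝓘(ℂ, EuclideanSpace ℂ (Fin n)) F z (1 : ℂ) = 0
    · rw [h]
      have := (fubiniStudy n).smul_left (F z) 0 0 0
      simp only [smul_zero, zero_mul] at this
      exact this.ge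
    · exact ((fubiniStudy n).pos _ _ h).le
  rw [HermitianMetric.normDeriv, Real.sq_sqrt hnn]
  have key : ∀ a b : EuclideanSpace ℂ (Fin n), a = b →
      fsCoord (coord k (F z)) a a = fsCoord (coord k (F z)) b b := by
    rintro a _ rfl; rfl
  exact key _ _ (hc1.symm.trans hc2)

/-- The energy density of a holomorphic curve in `ℂPⁿ` in terms of a lift to `ℂⁿ⁺¹`. -/
theorem normDeriv_fubiniStudy_sq_eq_fsHom {F : ℂ → CProj n} (hF : IsHolomorphicCurve n F)
    {V : ℂ → EuclideanSpace ℂ (Fin (n + 1))} (hV : Differentiable ℂ V) (hV0 : ∀ z, V z ≠ 0)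
    (hVF : ∀ z, mk (V z) (hV0 z) = F z) (z : ℂ) :
    (fubiniStudy n).normDeriv F z ^ 2 = fsHom (V z) (deriv V z) (deriv V z) := by
  obtain ⟨k, hk, h⟩ := normDeriv_fubiniStudy_sq hF z
  have hVk : V z k ≠ 0 := by rwa [← hVF, rep_mk_apply_ne_zero] at hk
  have hx := (differentiableAt_coord hF hk).hasDerivAt
  have h1 : HasDerivAt (fun z => lift k (coord k (F z)))
      (ins k (deriv (fun z => coord k (F z)) z)) z :=
    ((ins k).hasFDerivAt.comp_hasDerivAt z hx).add_const _
  have hc : HasDerivAt (fun z => V z k) (deriv V z k) z :=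
    (EuclideanSpace.proj (𝕜 := ℂ) k).hasFDerivAt.comp_hasDerivAt z (hV z).hasDerivAt
  have h2 := (hc.inv hVk).smul (hV z).hasDerivAt
  -- Near `z` the affine lift is `V` divided by its coordinate `k`, so its derivative is a multiple
  -- of `V'` plus a multiple of `V`, to which `fsHom_smul_add` applies.
  have heq : (fun z => lift k (coord k (F z))) =ᶠ[nhds z] fun z => (V z k)⁻¹ • V z := by
    filter_upwards [hc.continuousAt.eventually_ne hVk] with x hx
    rw [← hVF, coord_mk, lift_del _ _ hx]
  have h3 := (h1.congr_of_eventuallyEq heq.symm).unique h2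
  have h4 : lift k (coord k (F z)) = (V z k)⁻¹ • V z := heq.self_of_nhds
  rw [h, ← fsHom_lift k, h3, h4]
  exact fsHom_smul_add _ _ _ _ _ _ (inv_ne_zero hVk)

/-- The quotient of two linear forms is holomorphic along a holomorphic curve which avoids the zeros
of the denominator. -/
theorem differentiable_sum_mul_rep_div {F : ℂ → CProj n} (hF : IsHolomorphicCurve n F)
    (a b : Fin (n + 1) → ℂ) (hb : ∀ z, F z ∉ hyperplane b) :
    Differentiable ℂ fun z => (∑ j, a j * (F z).rep j) / ∑ j, b j * (F z).rep j := by
  intro z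
  obtain ⟨k, hk⟩ := (F z).exists_rep_apply_ne_zero
  have hx := differentiableAt_coord hF hk
  have hl : DifferentiableAt ℂ (fun z => lift k (coord k (F z))) z :=
    ((ins k).differentiableAt.comp z hx).add_const _
  -- The representative `rep` need not vary continuously. The affine lift does, and the scalar
  -- between them cancels in the quotient.
  have hlift : ∀ p : CProj n, p.rep k ≠ 0 → ∀ c : Fin (n + 1) → ℂ,
      ∑ j, c j * lift k (coord k p) j = (p.rep k)⁻¹ * ∑ j, c j * p.rep j := by
    intro p hp c
    rw [coord, lift_del k _ hp, Finset.mul_sum]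
    exact Finset.sum_congr rfl fun j _ => by simp only [PiLp.smul_apply, smul_eq_mul]; ring
  have hs : ∀ c : Fin (n + 1) → ℂ,
      DifferentiableAt ℂ (fun z => ∑ j, c j * lift k (coord k (F z)) j) z := by
    intro c
    refine DifferentiableAt.fun_sum fun j _ => DifferentiableAt.const_mul ?_ _
    exact (EuclideanSpace.proj (𝕜 := ℂ) j).differentiableAt.comp z hl
  have hb0 : ∑ j, b j * lift k (coord k (F z)) j ≠ 0 := by
    rw [hlift _ hk]
    exact mul_ne_zero (inv_ne_zero hk) (hb z)
  refine ((hs a).div (hs b) hb0).congr_of_eventuallyEq ?_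
  have hopen : ∀ᶠ x in nhds z, (F x).rep k ≠ 0 :=
    (hF z).continuousAt.eventually ((isOpen_source k).mem_nhds hk)
  filter_upwards [hopen] with x hx
  rw [Pi.div_apply, hlift _ hx, hlift _ hx, mul_div_mul_left _ _ (inv_ne_zero hx)]

/-- The linear automorphism of `ℂⁿ⁺¹` given by an invertible matrix. -/
theorem exists_continuousLinearEquiv_mulVec (A : Matrix (Fin (n + 1)) (Fin (n + 1)) ℂ)
    (hA : IsUnit A.det) :
    ∃ B : EuclideanSpace ℂ (Fin (n + 1)) ≃L[ℂ] EuclideanSpace ℂ (Fin (n + 1)),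
      ∀ Z i, B Z i = ∑ j, A i j * Z j := by
  refine ⟨(LinearEquiv.ofLinearMap (Matrix.toEuclideanLin A) (Matrix.toEuclideanLin A⁻¹)
    ?_ ?_).toContinuousLinearEquiv, fun Z i => ?_⟩
  · rw [← Matrix.toLpLin_mul_same, Matrix.mul_nonsing_inv A hA, Matrix.toLpLin_one]
  · rw [← Matrix.toLpLin_mul_same, Matrix.nonsing_inv_mul A hA, Matrix.toLpLin_one]
  · simp [Matrix.toLpLin_apply, Matrix.mulVec, dotProduct]

/-- A holomorphic curve with bounded derivative in the complement of `n + 1` linearly independent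
hyperplanes has packing density zero. -/
theorem packingDensity_eq_zero (A : Matrix (Fin (n + 1)) (Fin (n + 1)) ℂ) (hA : IsUnit A.det)
    {f : ℂ → hyperplaneComplement A} (hf : IsHolomorphicCurve n f) {C : ℝ}
    (hC : ∀ z, ((fubiniStudy n).restrict (hyperplaneComplement A)).normDeriv f z ≤ C) :
    ((fubiniStudy n).restrict (hyperplaneComplement A)).packingDensity f = 0 := by
  set F : ℂ → CProj n := fun z => (f z : CProj n) with hFdef
  have hF : IsHolomorphicCurve n F := hf.val
  have hAF : ∀ i z, F z ∉ hyperplane (A i) := fun i z h =>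
    (f z).2 (Set.mem_iUnion.2 ⟨i, h⟩)
  have hW0 : ∀ i z, (∑ j, A i j * (F z).rep j) / ∑ j, A 0 j * (F z).rep j ≠ 0 := fun i z =>
    div_ne_zero (hAF i z) (hAF 0 z)
  choose g hg hWg using fun i =>
    exists_differentiable_eq_exp (differentiable_sum_mul_rep_div hF (A i) (A 0) (hAF 0)) (hW0 i)
  have hg0 : ∀ z, (g 0 z).re = 0 := fun z => by
    have h := hWg 0 z
    rw [div_self (hAF 0 z)] at h
    rw [← Real.exp_eq_one_iff, ← Complex.norm_exp, ← h, norm_one]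
  let V : ℂ → EuclideanSpace ℂ (Fin (n + 1)) := fun z => WithLp.toLp 2 fun i => Complex.exp (g i z)
  have hVg : ∀ z i, V z i = Complex.exp (g i z) := fun _ _ => rfl
  have hV : Differentiable ℂ V := by
    rw [differentiable_piLp]
    exact fun j => (hg j).cexp
  obtain ⟨B, hB⟩ := exists_continuousLinearEquiv_mulVec A hA
  have hBrep : ∀ z, V z = (∑ j, A 0 j * (F z).rep j)⁻¹ • B (F z).rep := fun z => by
    ext i
    rw [hVg, ← hWg, PiLp.smul_apply, hB, smul_eq_mul, div_eq_inv_mul]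
  have hV0 : ∀ z, V z ≠ 0 := fun z h => Complex.exp_ne_zero (g 0 z) (by rw [← hVg, h]; rfl)
  have hZ0 : ∀ z, B.symm (V z) ≠ 0 := fun z => by simpa using hV0 z
  have hZ : Differentiable ℂ fun z => B.symm (V z) := B.symm.differentiable.comp hV
  have hZF : ∀ z, mk (B.symm (V z)) (hZ0 z) = F z := fun z => by
    rw [← (F z).mk_rep]
    refine mk_eq_mk _ _ (∑ j, A 0 j * (F z).rep j)⁻¹ ?_
    rw [hBrep, map_smul, B.symm_apply_apply]
  have hdZ : ∀ z, deriv (fun z => B.symm (V z)) z = B.symm (deriv V z) := fun z =>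
    (B.symm.hasFDerivAt.comp_hasDerivAt z (hV z).hasDerivAt).deriv
  have hD : ∀ z, ((fubiniStudy n).restrict (hyperplaneComplement A)).normDeriv f z ^ 2 =
      fsHom (B.symm (V z)) (deriv (fun z => B.symm (V z)) z) (deriv (fun z => B.symm (V z)) z) :=
    fun z => by
      rw [HermitianMetric.normDeriv_restrict _ hf,
        normDeriv_fubiniStudy_sq_eq_fsHom hF hZ hZ0 hZF]
  have hbound : ∀ z, fsHom (B.symm (V z)) (deriv (fun z => B.symm (V z)) z)
      (deriv (fun z => B.symm (V z)) z) ≤ C ^ 2 := fun z => by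
    rw [← hD]
    exact pow_le_pow_left₀ (Real.sqrt_nonneg _) (hC z) 2
  -- `K₁` transfers the energy bound from the curve to `V`; `K₂` transfers the decay along rays
  -- back.
  obtain ⟨K₁, hK₁, h₁⟩ := exists_fsHom_map_le B
  obtain ⟨K₂, -, h₂⟩ := exists_fsHom_map_le B.symm
  have hVbound : ∀ z, fsHom (V z) (deriv V z) (deriv V z) ≤ K₁ * C ^ 2 := fun z => by
    have h := h₁ (B.symm (V z)) (B.symm (deriv V z)) (hZ0 z)
    rw [B.apply_symm_apply, B.apply_symm_apply, ← hdZ] at h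
    exact h.trans (mul_le_mul_of_nonneg_left (hbound z) hK₁)
  rw [HermitianMetric.packingDensity]
  simp only [hD]
  refine limsup_mean_eq_zero (continuous_fsHom_deriv hZ hZ0) hbound ?_
  filter_upwards [ae_tendsto_fsHom_exp hg hg0 hVg hVbound] with w hw
  refine squeeze_zero (fun R => fsHom_self_nonneg _ _) (fun R => ?_)
    (by simpa using hw.const_mul K₂)
  rw [hdZ]
  exact h₂ _ _ (hV0 _)

end CProj

/-- Let `H₀, …, Hₙ` be the hyperplanes in `ℂPⁿ` defined by the rows of a regular matrix `A`. The
complement of `H₀ ∪ … ∪ Hₙ` with the restricted Fubini–Study metric has holomorphic capacity `0`, and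
every entire curve with bounded derivative in it has packing density `0`. -/
theorem mainTheorem5 (n : ℕ) (A : Matrix (Fin (n + 1)) (Fin (n + 1)) ℂ) (hA : IsUnit A.det) :
    ((CProj.fubiniStudy n).restrict (CProj.hyperplaneComplement A)).capacity = 0 ∧
    ∀ f : ℂ → CProj.hyperplaneComplement A, IsHolomorphicCurve n f →
      (∃ C : ℝ, ∀ z,
        ((CProj.fubiniStudy n).restrict (CProj.hyperplaneComplement A)).normDeriv f z ≤ C) →
      ((CProj.fubiniStudy n).restrict (CProj.hyperplaneComplement A)).packingDensity f = 0 := by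
  refine ⟨?_, fun f hf ⟨C, hC⟩ => CProj.packingDensity_eq_zero A hA hf hC⟩
  rw [HermitianMetric.capacity, ← ENNReal.bot_eq_zero, iSup₂_eq_bot]
  -- Curves in the moduli space satisfy the boundedness hypothesis with `C = 1`.
  exact fun f hf => CProj.packingDensity_eq_zero A hA hf.1 hf.2
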